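/- Notation. For $d\ge 2$ write $x=(\tilde x,x_d)\in[0,1]^{d-1}\times[0,1]$. For $K>0$, $\gamma\ge1$, let $\Sigma(K,\gamma)$ be the set of $g:[0,1]^{d-1}\to[0,1]$ that are $\lfloor\gamma\rfloor$ times continuously differentiable with $\bigl|g(y)-\sum_{m=0}^{\lfloor\gamma\rfloor}\frac{1}{m!}\partial^m g(x)(y-x)^m\bigr|\le K\|y-x\|^\gamma$ for all $x,y$ (Euclidean norm). A labeler $L$ assigns to each ground truth $g^*\in\Sigma(K,\gamma)$ a response distribution $P(Y=\cdot\mid x)$ on $\{0,1,\perp\}$, measurable in $x\in[0,1]^d$; $\perp$ is an abstention. For $f:[0,1]\to[0,1]$ nondecreasing and $C,\beta\ge0$, consider the following conditions, required for every $g^*\in\Sigma(K,\gamma)$ (the noise parts only where $P(\perp\mid x)<1$): 1. (i) for all $\tilde x\in[0,1]^{d-1}$ and $x_d,x_d'\in[0,1]$, $P(\perp\mid(\tilde x,x_d))\le P(\perp\mid(\tilde x,x_d'))$ whenever $|x_d-g^*(\tilde x)|\ge|x_d'-g^*(\tilde x)|$; (ii) $P(Y\ne\mathbb 1[x_d>g^*(\tilde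 x)]\mid x,Y\neq\perp)\le\frac12$ for all $x$. 2. For all $x$: $P(\perp\mid x)\le 1-f(|x_d-g^*(\tilde x)|)$ and $P(Y\ne\mathbb 1[x_d>g^*(\tilde x)]\mid x,Y\ne\perp)\le\frac12\bigl(1-C|x_d-g^*(\tilde x)|^\beta\bigr)$. 3. There is $c'\in(0,1)$ such that $f(a)>0$ and $f(b)/f(a)\le 1-c'$ for all $0<a\le1$, $0\le b\le\frac23a$; and $P(\perp\mid x)=1-f(|x_d-g^*(\tilde x)|)$ for all $x$. An active learning algorithm $\mathcal A$ is a (possibly randomized) procedure that adaptively chooses query points in $[0,1]^d$, receives for each query an independent response drawn from $P(\cdot\mid x)$, and may at any time stop and output a function $g:[0,1]^{d-1}\to\mathbb R$. Its query complexity $\Lambda(\epsilon,\delta,\mathcal A,L,g^*)\in\{0,1,2,\dots,\infty\}$ is the least $n$ such that, with probability at least $1-\delta$, $\mathcal A$ stops after at most $n$ queries with an output satisfying $\int_{[0,1]^{d-1}}|g-g^*|\le\epsilon$. Theorem. There is a universal constant $\delta_0\in(0,1)$ such that for all $d\ge2$, $K>0$, $\gamma\ge1$, $0<C'\le1$, $0<\alpha\le2$,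 $0\le C\le1$ and $\beta\ge0$ there is a labeler $L$ satisfying Conditions 1, 2 and 3 with $f(x)=C'x^\alpha$ for which the following holds: there are $c>0$ and $\epsilon_0>0$ such that for every $0<\epsilon\le\epsilon_0$ and every active learning algorithm $\mathcal A$ (which may depend on $\epsilon$) there is a $g^*\in\Sigma(K,\gamma)$ with $$\Lambda(\epsilon,\delta_0,\mathcal A,L,g^*)\ \ge\ c\,\epsilon^{-\alpha-\frac{d-1}{\gamma}} .$$ -/

import Mathlib

open MeasureTheory Set
open scoped ENNReal

universe u

noncomputable section

namespace AbstainingLabeler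

/-! ### Instance space and smooth boundary fragments -/

/-- The cube `[0,1]^{d-1}` in Euclidean space. -/
def baseCube (d : ℕ) : Set (EuclideanSpace ℝ (Fin (d - 1))) :=
  {x | ∀ i, x i ∈ Icc (0 : ℝ) 1}

/-- The points `x̃` of `[0,1]^{d-1}`. -/
abbrev BasePoint (d : ℕ) : Type := ↥(baseCube d)

/-- The instance space `[0,1]^d`; a point is a pair `x = (x̃, x_d)`. -/
abbrev InstancePoint (d : ℕ) : Type := BasePoint d × ↥(Icc (0 : ℝ) 1)

/-- `(K, γ)`-Hölder smoothness on `[0,1]^{d-1}`: `g` is the restriction of a function `G`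
that is `⌊γ⌋` times continuously differentiable on the cube (one-sided derivatives at the
boundary), and the Taylor polynomial of order `⌊γ⌋` approximates it up to `K ‖y - x‖ ^ γ`.
The derivatives within the cube depend only on `g`, not on the values of `G` elsewhere. -/
def IsHolderSmooth {d : ℕ} (K γ : ℝ) (g : BasePoint d → ℝ) : Prop :=
  ∃ G : EuclideanSpace ℝ (Fin (d - 1)) → ℝ,
    (∀ x : BasePoint d, G x = g x) ∧
    ContDiffOn ℝ (⌊γ⌋₊ : ℕ) G (baseCube d) ∧
    ∀ x ∈ baseCube d, ∀ y ∈ baseCube d,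
      |G y - ∑ m ∈ Finset.range (⌊γ⌋₊ + 1),
          iteratedFDerivWithin ℝ m G (baseCube d) x (fun _ => y - x) / (m.factorial : ℝ)|
        ≤ K * ‖y - x‖ ^ γ

/-- The decision boundaries `g : [0,1]^{d-1} → [0,1]` in `Σ(K, γ)`. -/
def smoothBoundaries (d : ℕ) (K γ : ℝ) : Set (BasePoint d → ℝ) :=
  {g | (∀ x, g x ∈ Icc (0 : ℝ) 1) ∧ IsHolderSmooth K γ g}

/-- Lebesgue measure on `[0,1]^{d-1}`. -/
def cubeVolume (d : ℕ) : Measure (BasePoint d) :=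
  Measure.comap Subtype.val volume

/-- The `L¹` distance `∫ |g - g'|` over `[0,1]^{d-1}` (infinite if the integral diverges). -/
def boundaryDist {d : ℕ} (g g' : BasePoint d → ℝ) : ℝ≥0∞ :=
  ∫⁻ x, ENNReal.ofReal |g x - g' x| ∂cubeVolume d

/-- The label `1[x_d > g(x̃)]`. -/
def trueLabel {d : ℕ} (g : BasePoint d → ℝ) (x : InstancePoint d) : Bool :=
  open Classical in decide (g x.1 < (x.2 : ℝ))

/-- The vertical distance `|x_d - g(x̃)|` to the decision boundary. -/
def gap {d : ℕ} (g : BasePoint d → ℝ) (x : InstancePoint d) : ℝ :=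
  |(x.2 : ℝ) - g x.1|

/-! ### Labeler responses and the three conditions -/

/-- The responses `{0, 1, ⊥}`: `some b` is the label `b`, and `none` is the abstention `⊥`. -/
abbrev Response : Type := Option Bool

/-- A response distribution `P(Y = · | X = x)`. -/
abbrev ResponseLaw (d : ℕ) : Type := InstancePoint d → PMF Response

/-- `P(⊥ | x)`. -/
def abstainProb {d : ℕ} (P : ResponseLaw d) (x : InstancePoint d) : ℝ :=
  (P x none).toReal

/-- `P(Y ≠ 1[x_d > g(x̃)] | x, Y ≠ ⊥)`, meaningful where `P(⊥ | x) < 1`. -/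
def noiseRate {d : ℕ} (P : ResponseLaw d) (g : BasePoint d → ℝ) (x : InstancePoint d) : ℝ :=
  (P x (some (!trueLabel g x))).toReal /
    ((P x (some false)).toReal + (P x (some true)).toReal)

/-- First condition, for the response distribution `P` and the ground truth `g`. -/
def Condition1 {d : ℕ} (P : ResponseLaw d) (g : BasePoint d → ℝ) : Prop :=
  (∀ (t : BasePoint d) (s s' : ↥(Icc (0 : ℝ) 1)),
      gap g (t, s') ≤ gap g (t, s) → abstainProb P (t, s) ≤ abstainProb P (t, s')) ∧
  (∀ x, abstainProb P x < 1 → noiseRate P g x ≤ 1 / 2)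

/-- `f` is a nondecreasing function from `[0,1]` to `[0,1]`. -/
def IsRate (f : ℝ → ℝ) : Prop :=
  MonotoneOn f (Icc 0 1) ∧ MapsTo f (Icc 0 1) (Icc 0 1)

/-- Second condition, with parameters `f`, `C`, `β`. -/
def Condition2 {d : ℕ} (f : ℝ → ℝ) (C β : ℝ) (P : ResponseLaw d) (g : BasePoint d → ℝ) :
    Prop :=
  IsRate f ∧ 0 ≤ C ∧ 0 ≤ β ∧
  (∀ x, abstainProb P x ≤ 1 - f (gap g x)) ∧
  (∀ x, abstainProb P x < 1 → noiseRate P g x ≤ 1 / 2 * (1 - C * gap g x ^ β))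

/-- Third condition, with parameter `f`. -/
def Condition3 {d : ℕ} (f : ℝ → ℝ) (P : ResponseLaw d) (g : BasePoint d → ℝ) : Prop :=
  IsRate f ∧
  (∃ c : ℝ, 0 < c ∧ c < 1 ∧ ∀ a : ℝ, 0 < a → a ≤ 1 → ∀ b : ℝ, 0 ≤ b → b ≤ 2 / 3 * a →
      0 < f a ∧ f b / f a ≤ 1 - c) ∧
  (∀ x, abstainProb P x = 1 - f (gap g x))

/-! ### Active learning algorithms and query complexity -/

/-- A randomized adaptive algorithm with membership queries. Its internal randomness is a
seed, drawn once. A history is the list of the responses received so far, the latest one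
first; together with the seed it determines all earlier query points. At each history the
algorithm either stops and outputs a boundary (any real function on `[0,1]^{d-1}`, not
necessarily a smooth one) or queries a point. It need not stop. -/
structure ActiveLearner (d : ℕ) where
  /-- the space of seeds -/
  Seed : Type u
  [seedSpace : MeasurableSpace Seed]
  /-- the law of the seed -/
  seedLaw : Measure Seed
  [seedProb : IsProbabilityMeasure seedLaw]
  /-- whether to stop at a given history -/
  halt : List Response → Seed → Prop
  /-- the next point to query, if the algorithm does not stop -/
  query : List Response → Seed → InstancePoint d
  /-- the output, if the algorithm stops -/
  output : List Response → Seed → BasePoint d → ℝ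
  measurable_halt : ∀ h, MeasurableSet {w | halt h w}
  measurable_query : ∀ h, Measurable (query h)
  measurable_output : ∀ h, Measurable (fun p : Seed × BasePoint d => output h p.1 p.2)

attribute [instance] ActiveLearner.seedSpace ActiveLearner.seedProb

variable {d : ℕ}

open Classical in
/-- The law, for a fixed seed `w`, of the history after `n` rounds. In each round in which the
algorithm has not stopped it makes one query, and the answer is drawn from `P` at the queried
point, independently of the past given that point. -/
def ActiveLearner.history (A : ActiveLearner.{u} d) (P : ResponseLaw d) (w : A.Seed) :
    ℕ → PMF (List Response)
  | 0 => PMF.pure []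
  | n + 1 => (A.history P w n).bind fun h =>
      if A.halt h w then PMF.pure h else (P (A.query h w)).map (fun y => y :: h)

/-- The probability that the algorithm stops after at most `n` queries with an output at `L¹`
distance at most `ε` from the ground truth `g`, if the responses follow `P`. -/
def ActiveLearner.successProb (A : ActiveLearner.{u} d) (P : ResponseLaw d)
    (g : BasePoint d → ℝ) (ε : ℝ) (n : ℕ) : ℝ≥0∞ :=
  ∫⁻ w, (A.history P w n).toOuterMeasure
    {h | A.halt h w ∧ boundaryDist (A.output h w) g ≤ ENNReal.ofReal ε} ∂A.seedLaw

/-- The query complexity `Λ(ε, δ, A, L, g)`, where `P` is the response distribution of the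
labeler `L` with ground truth `g`: the least `n` such that with probability at least `1 - δ`
the algorithm stops after at most `n` queries with an `ε`-accurate output
(`∞` if there is no such `n`). -/
def ActiveLearner.queryComplexity (A : ActiveLearner.{u} d) (P : ResponseLaw d)
    (g : BasePoint d → ℝ) (ε δ : ℝ) : ℝ≥0∞ :=
  ⨅ (n : ℕ) (_ : ENNReal.ofReal (1 - δ) ≤ A.successProb P g ε n), (n : ℝ≥0∞)

end AbstainingLabeler

end

/-! The labeler never lies and answers with probability exactly `C' * gap ^ α`, so near the boundary
it almost always abstains. The hard instances are boundaries at height `1 / 2`, raised by bumps of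
height `η` over an arbitrary set of the `N = m ^ (d - 1)` cells of a grid. The `j`-th derivatives of
such a boundary are of order `η * m ^ j`, so `η * m ^ γ ≲ K` keeps it in the class
(`exists_cubeBoundary_mem_smoothBoundaries`). Each wrongly guessed bit costs about `η / N` in `L¹`,
so for `η` a large multiple of `ε` an `ε`-accurate output determines all but a small fraction of the
bits (`card_ne_le_of_boundaryDist_le`).

Flipping the bit of one cell changes the responses only in the column above that cell. There the
square roots of the answer probabilities move by at most `η ^ (α / 2)`, because `r ↦ r ^ (α / 2)` is
Hölder for `α ≤ 2`; a query between the two boundaries is answered with probability at most `η ^ α`.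
Hence a query carries squared Hellinger information of order `η ^ α`, about one bit only
(`one_le_affinity_noiselessLabeler_add`).

An Assouad argument for adaptive queries (`ActiveLearner.sum_toOuterMeasure_le`) then shows that of
order `N * η ^ (-α)` queries are necessary. With `η ≍ ε` and `m ≍ ε ^ (-1 / γ)` this is the claimed
rate. Averaging over all bump patterns treats randomized algorithms seed by seed. -/

noncomputable section

namespace AbstainingLabeler

/-! ### Hellinger affinity of discrete distributions -/

/-- The Hellinger affinity `∑ √(p a * q a)`. -/
def affinity {α : Type*} (p q : PMF α) : ℝ≥0∞ :=
  ∑' a, (p a * q a) ^ (1 / 2 : ℝ)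

theorem sqrt_mul_self (a : ℝ≥0∞) : (a * a) ^ (1 / 2 : ℝ) = a := by
  rw [← sq, ← ENNReal.rpow_natCast, ← ENNReal.rpow_mul]
  norm_num

theorem sqrt_mul_le_add_quarter (a b : ℝ≥0∞) : (a * b) ^ (1 / 2 : ℝ) ≤ a + b / 4 := by
  rcases eq_or_ne a ⊤ with rfl | ha
  · simp
  rcases eq_or_ne b ⊤ with rfl | hb
  · simp [ENNReal.top_div]
  lift a to NNReal using ha
  lift b to NNReal using hb
  have h : (a : ℝ≥0∞) * b ≤ (a + b / 4) * (a + b / 4) := by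
    have h4 : (b : ℝ≥0∞) / 4 = ((b / 4 : NNReal) : ℝ≥0∞) := by
      rw [ENNReal.coe_div (by norm_num)]; rfl
    rw [h4]
    norm_cast
    rw [← NNReal.coe_le_coe]
    push_cast
    nlinarith [sq_nonneg ((a : ℝ) - b / 4)]
  calc ((a : ℝ≥0∞) * b) ^ (1 / 2 : ℝ) ≤ ((a + b / 4) * (a + b / 4)) ^ (1 / 2 : ℝ) := by
        gcongr
    _ = _ := sqrt_mul_self _

theorem sqrt_mul_le_half_add (a b : ℝ≥0∞) : (a * b) ^ (1 / 2 : ℝ) ≤ (a + b) / 2 := by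
  rcases eq_or_ne a ⊤ with rfl | ha
  · simp [ENNReal.top_div]
  rcases eq_or_ne b ⊤ with rfl | hb
  · simp [ENNReal.top_div]
  lift a to NNReal using ha
  lift b to NNReal using hb
  have h : (a : ℝ≥0∞) * b ≤ ((a + b) / 2) * ((a + b) / 2) := by
    have h4 : ((a : ℝ≥0∞) + b) / 2 = (((a + b) / 2 : NNReal) : ℝ≥0∞) := by
      rw [ENNReal.coe_div (by norm_num)]; push_cast; rfl
    rw [h4]
    norm_cast
    rw [← NNReal.coe_le_coe]
    push_cast
    nlinarith [sq_nonneg ((a : ℝ) - b)]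
  calc ((a : ℝ≥0∞) * b) ^ (1 / 2 : ℝ) ≤ (((a + b) / 2) * ((a + b) / 2)) ^ (1 / 2 : ℝ) := by
        gcongr
    _ = _ := sqrt_mul_self _

theorem sqrt_mul_le_min_add (a b : ℝ≥0∞) :
    (a * b) ^ (1 / 2 : ℝ) ≤ min a b + (a + b) / 4 := by
  rcases le_total a b with h | h
  · rw [min_eq_left h]
    refine (sqrt_mul_le_add_quarter a b).trans ?_
    gcongr
    exact le_add_self
  · rw [min_eq_right h, mul_comm]
    refine (sqrt_mul_le_add_quarter b a).trans ?_
    gcongr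
    exact le_self_add

theorem tsum_sqrt_mul_le {α : Type*} (u v : α → ℝ≥0∞) :
    ∑' a, (u a * v a) ^ (1 / 2 : ℝ) ≤ ((∑' a, u a) * ∑' a, v a) ^ (1 / 2 : ℝ) := by
  let : MeasurableSpace α := ⊤
  have h := ENNReal.lintegral_mul_le_Lp_mul_Lq (Measure.count : Measure α)
    (p := 2) (q := 2) Real.HolderConjugate.two_two
    (f := fun a => u a ^ (1 / 2 : ℝ)) (g := fun a => v a ^ (1 / 2 : ℝ))
    (measurable_from_top).aemeasurable (measurable_from_top).aemeasurable
  rw [lintegral_count, lintegral_count, lintegral_count] at h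
  simp only [Pi.mul_apply, ← ENNReal.rpow_mul] at h
  norm_num at h
  simp only [ENNReal.mul_rpow_of_nonneg _ _ (by norm_num : (0 : ℝ) ≤ 1 / 2)]
  exact h

/-- The left side is the affinity of the joint laws of `(a, b)`; forgetting `a` can only raise it,
by Cauchy–Schwarz over `a` for each fixed `b`. -/
theorem tsum_mul_affinity_le_affinity_bind {α β : Type*} (p q : PMF α) (K K' : α → PMF β) :
    ∑' a, (p a * q a) ^ (1 / 2 : ℝ) * affinity (K a) (K' a)
      ≤ affinity (p.bind K) (q.bind K') := by
  unfold affinity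
  simp_rw [← ENNReal.tsum_mul_left]
  rw [ENNReal.tsum_comm]
  refine ENNReal.tsum_le_tsum fun b => ?_
  rw [PMF.bind_apply, PMF.bind_apply]
  refine le_trans (le_of_eq ?_) (tsum_sqrt_mul_le _ _)
  refine tsum_congr fun a => ?_
  rw [← ENNReal.mul_rpow_of_nonneg _ _ (by norm_num)]
  congr 1
  ring

theorem affinity_self {α : Type*} (p : PMF α) : affinity p p = 1 := by
  unfold affinity
  simp_rw [sqrt_mul_self]
  exact p.tsum_coe

theorem affinity_le_affinity_map {α β : Type*} (f : α → β) (p q : PMF α) :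
    affinity p q ≤ affinity (p.map f) (q.map f) := by
  refine le_trans (le_of_eq ?_)
    (tsum_mul_affinity_le_affinity_bind p q (PMF.pure ∘ f) (PMF.pure ∘ f))
  simp [affinity]

/-- A linear form of Le Cam's comparison: weighted AM–GM bounds each term by the minimum plus a
quarter of the sum, and these quarters add up to `1 / 2`. Linearity allows summing over all edges of
the hypercube. -/
theorem affinity_le_tsum_min_add_half {α : Type*} (p q : PMF α) :
    affinity p q ≤ ∑' a, min (p a) (q a) + 1 / 2 := by
  calc affinity p q ≤ ∑' a, (min (p a) (q a) + (p a + q a) / 4) :=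
        ENNReal.tsum_le_tsum fun a => sqrt_mul_le_min_add _ _
    _ = ∑' a, min (p a) (q a) + 1 / 2 := by
        rw [ENNReal.tsum_add]
        simp_rw [div_eq_mul_inv]
        rw [ENNReal.tsum_mul_right, ENNReal.tsum_add, p.tsum_coe, q.tsum_coe]
        congr 1
        rw [one_add_one_eq_two, ← div_eq_mul_inv, one_mul,
          ← ENNReal.toReal_eq_toReal_iff' (by finiteness) (by finiteness)]
        norm_num

/-! ### Adaptive query protocols -/

variable {d : ℕ}

open Classical in
/-- The law of the next history. -/
def ActiveLearner.step (A : ActiveLearner.{u} d) (P : ResponseLaw d) (w : A.Seed)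
    (h : List Response) : PMF (List Response) :=
  if A.halt h w then PMF.pure h else (P (A.query h w)).map (fun y => y :: h)

theorem ActiveLearner.history_succ (A : ActiveLearner.{u} d) (P : ResponseLaw d) (w : A.Seed)
    (n : ℕ) : A.history P w (n + 1) = (A.history P w n).bind (A.step P w) := rfl

open Classical in
/-- The probability that the query of round `t + 1` is made and falls into `c`. -/
def ActiveLearner.visitProb (A : ActiveLearner.{u} d) (P : ResponseLaw d) (w : A.Seed)
    (c : Set (InstancePoint d)) (t : ℕ) : ℝ≥0∞ :=
  ∑' h, A.history P w t h * (if ¬ A.halt h w ∧ A.query h w ∈ c then 1 else 0)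

/-- A round lowers the affinity only through histories whose next query lands in `c`, each by at
most `κ` times its share. The loss is thus charged to visits to `c`, not to the round itself. -/
theorem ActiveLearner.affinity_history_le_succ (A : ActiveLearner.{u} d) {P Q : ResponseLaw d}
    (w : A.Seed) {c : Set (InstancePoint d)} {κ : ℝ≥0∞}
    (hPQ : ∀ x, 1 ≤ affinity (P x) (Q x) + c.indicator (fun _ => κ) x) (t : ℕ) :
    affinity (A.history P w t) (A.history Q w t)
      ≤ affinity (A.history P w (t + 1)) (A.history Q w (t + 1))
        + κ / 2 * (A.visitProb P w c t + A.visitProb Q w c t) := by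
  classical
  set p := A.history P w t
  set q := A.history Q w t
  have hstep : ∀ h, 1 ≤ affinity (A.step P w h) (A.step Q w h)
      + κ * (if ¬ A.halt h w ∧ A.query h w ∈ c then 1 else 0) := by
    intro h
    by_cases hh : A.halt h w
    · simp [ActiveLearner.step, hh, affinity_self]
    · simp only [ActiveLearner.step, hh, if_false, not_false_eq_true, true_and]
      refine (hPQ (A.query h w)).trans ?_
      refine add_le_add (affinity_le_affinity_map _ _ _) ?_
      by_cases hc : A.query h w ∈ c <;> simp [hc]
  calc affinity p q = ∑' h, (p h * q h) ^ (1 / 2 : ℝ) * 1 := by simp [affinity]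
    _ ≤ ∑' h, ((p h * q h) ^ (1 / 2 : ℝ) * affinity (A.step P w h) (A.step Q w h)
          + κ / 2 * (p h * (if ¬ A.halt h w ∧ A.query h w ∈ c then 1 else 0)
            + q h * (if ¬ A.halt h w ∧ A.query h w ∈ c then 1 else 0))) := by
        refine ENNReal.tsum_le_tsum fun h => ?_
        refine (mul_le_mul_right (hstep h) _).trans ?_
        rw [mul_add]
        refine add_le_add_right ?_ _
        -- AM–GM splits the weight `√(p h * q h)` of a visit into visit probabilities under the two
        -- laws.
        refine (mul_le_mul_left (sqrt_mul_le_half_add (p h) (q h)) _).trans (le_of_eq ?_)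
        simp only [div_eq_mul_inv]
        ring
    _ = ∑' h, (p h * q h) ^ (1 / 2 : ℝ) * affinity (A.step P w h) (A.step Q w h)
          + κ / 2 * (A.visitProb P w c t + A.visitProb Q w c t) := by
        rw [ENNReal.tsum_add, ENNReal.tsum_mul_left, ENNReal.tsum_add]
        rfl
    _ ≤ _ := by
        gcongr
        rw [A.history_succ, A.history_succ]
        exact tsum_mul_affinity_le_affinity_bind _ _ _ _

theorem ActiveLearner.one_le_affinity_history_add (A : ActiveLearner.{u} d)
    {P Q : ResponseLaw d} (w : A.Seed) {c : Set (InstancePoint d)} {κ : ℝ≥0∞}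
    (hPQ : ∀ x, 1 ≤ affinity (P x) (Q x) + c.indicator (fun _ => κ) x) (n : ℕ) :
    1 ≤ affinity (A.history P w n) (A.history Q w n)
        + κ / 2 * (∑ t ∈ Finset.range n, A.visitProb P w c t
          + ∑ t ∈ Finset.range n, A.visitProb Q w c t) := by
  induction n with
  | zero => simp [ActiveLearner.history, affinity_self]
  | succ n ih =>
    refine ih.trans ?_
    refine (add_le_add_left (A.affinity_history_le_succ w hPQ n) _).trans (le_of_eq ?_)
    rw [Finset.sum_range_succ, Finset.sum_range_succ]
    ring

/-- Disjointness lets each query count for at most one cell, so the cells share a budget of `n`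
visits however adaptive the queries are. -/
theorem ActiveLearner.sum_visitProb_le {ι : Type*} [Fintype ι] (A : ActiveLearner.{u} d)
    (P : ResponseLaw d) (w : A.Seed) {c : ι → Set (InstancePoint d)}
    (hc : Pairwise fun i j => Disjoint (c i) (c j)) (n : ℕ) :
    ∑ k, ∑ t ∈ Finset.range n, A.visitProb P w (c k) t ≤ n := by
  classical
  rw [Finset.sum_comm]
  have h1 : ∀ t, ∑ k, A.visitProb P w (c k) t ≤ 1 := by
    intro t
    unfold ActiveLearner.visitProb
    rw [← Summable.tsum_finsetSum (fun _ _ => ENNReal.summable)]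
    refine le_trans ?_ (A.history P w t).tsum_coe.le
    refine ENNReal.tsum_le_tsum fun h => ?_
    rw [← Finset.mul_sum]
    refine mul_le_of_le_one_right' ?_
    rw [Finset.sum_boole]
    norm_cast
    rw [Finset.card_le_one]
    intro i hi j hj
    simp only [Finset.mem_filter] at hi hj
    by_contra hij
    exact Set.disjoint_left.1 (hc hij) hi.2.2 hj.2.2
  calc _ ≤ ∑ t ∈ Finset.range n, (1 : ℝ≥0∞) := Finset.sum_le_sum fun t _ => h1 t
    _ = n := by simp

/-- The vertex of the hypercube `ι → Bool` adjacent to `b` in direction `k`. -/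
def flipAt {ι : Type*} [DecidableEq ι] (k : ι) (b : ι → Bool) : ι → Bool :=
  Function.update b k (!b k)

theorem flipAt_involutive {ι : Type*} [DecidableEq ι] (k : ι) :
    Function.Involutive (flipAt k) := by
  intro b
  simp [flipAt]

theorem sum_flipAt {ι : Type*} [Fintype ι] [DecidableEq ι] (k : ι) (F : (ι → Bool) → ℝ≥0∞) :
    ∑ b, F (flipAt k b) = ∑ b, F b :=
  Equiv.sum_comp (flipAt_involutive k).toPerm F

/-- Two-point comparison along an edge of the hypercube. -/
theorem tsum_min_le_error_add {α ι : Type*} [DecidableEq ι] (p q : PMF α)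
    (est : α → ι → Bool) (b : ι → Bool) (k : ι) :
    ∑' h, min (p h) (q h) ≤ ∑' h, p h * (if est h k ≠ b k then 1 else 0)
      + ∑' h, q h * (if est h k ≠ flipAt k b k then 1 else 0) := by
  rw [← ENNReal.tsum_add]
  refine ENNReal.tsum_le_tsum fun h => ?_
  -- The endpoints differ in coordinate `k`, so the estimate errs at one of them and its error term
  -- dominates the minimum.
  by_cases hb : est h k = b k
  · have : est h k ≠ flipAt k b k := by simp [flipAt, hb]
    simp [hb, flipAt]
  · simp [hb]

/-- Assouad's lemma for adaptive queries: if every query distinguishes the two endpoints of at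
most one edge direction, and only with squared Hellinger distance `κ`, then on average over the
hypercube the vertex cannot be located from few queries. -/
theorem ActiveLearner.sum_toOuterMeasure_le {ι : Type*} [Fintype ι] [DecidableEq ι] [Nonempty ι]
    (A : ActiveLearner.{u} d) (w : A.Seed) (P : (ι → Bool) → ResponseLaw d)
    {c : ι → Set (InstancePoint d)} (hc : Pairwise fun i j => Disjoint (c i) (c j))
    {κ : ℝ≥0∞}
    (hP : ∀ b k x, 1 ≤ affinity (P b x) (P (flipAt k b) x) + (c k).indicator (fun _ => κ) x)
    {n : ℕ} (hn : 4 * (κ * n) ≤ Fintype.card ι)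
    (S : (ι → Bool) → Set (List Response))
    (hS : ∀ h b b', h ∈ S b → h ∈ S b' →
      32 * (Finset.univ.filter fun k => b k ≠ b' k).card ≤ Fintype.card ι) :
    31 * ∑ b, (A.history (P b) w n).toOuterMeasure (S b) ≤ 28 * 2 ^ Fintype.card ι := by
  classical
  set N := Fintype.card ι with hN
  set p := fun b => A.history (P b) w n with hp
  -- Any vertex compatible with the history serves as estimate: by `hS` all compatible ones are
  -- close to each other. The default value matters only for histories that succeed at no vertex.
  set est : List Response → ι → Bool :=
    fun h => if H : ∃ b, h ∈ S b then H.choose else fun _ => false with hest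
  have hest' : ∀ h b, h ∈ S b →
      32 * (Finset.univ.filter fun k => est h k ≠ b k).card ≤ N := by
    intro h b hb
    have H : ∃ b, h ∈ S b := ⟨b, hb⟩
    have : est h = H.choose := by simp only [hest, dif_pos H]
    rw [this]
    exact hS h _ _ H.choose_spec hb
  set T := fun b k => ∑ t ∈ Finset.range n, A.visitProb (P b) w (c k) t with hT
  set err := fun b k => ∑' h, p b h * (if est h k ≠ b k then 1 else 0) with herr
  set E := ∑ b, ∑ k, err b k with hE
  set s := ∑ b, (p b).toOuterMeasure (S b) with hs
  have hcard : Fintype.card (ι → Bool) = 2 ^ N := by simp [hN]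
  have hedge : ∀ b k, 1 ≤ err b k + err (flipAt k b) k + 1 / 2
      + κ / 2 * (T b k + T (flipAt k b) k) := by
    intro b k
    refine (A.one_le_affinity_history_add w (hP b k) n).trans ?_
    gcongr
    refine (affinity_le_tsum_min_add_half _ _).trans ?_
    gcongr
    exact tsum_min_le_error_add _ _ est b k
  -- The edge inequality is summed over all vertices and directions. Flipping permutes the vertices,
  -- which doubles the error and visit terms, and the visit budget bounds the latter by `n` per
  -- vertex.
  have hlow : (N : ℝ≥0∞) * 2 ^ N ≤ 2 * E + N * 2 ^ N * (1 / 2) + κ * (n * 2 ^ N) := by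
    calc (N : ℝ≥0∞) * 2 ^ N = ∑ k : ι, ∑ b : ι → Bool, (1 : ℝ≥0∞) := by simp [hcard, hN]
      _ ≤ ∑ k, ∑ b, (err b k + err (flipAt k b) k + 1 / 2
            + κ / 2 * (T b k + T (flipAt k b) k)) :=
          Finset.sum_le_sum fun k _ => Finset.sum_le_sum fun b _ => hedge b k
      _ = ∑ k, (2 * ∑ b, err b k + 2 ^ N * (1 / 2) + κ * ∑ b, T b k) := by
          refine Finset.sum_congr rfl fun k _ => ?_
          simp_rw [Finset.sum_add_distrib, ← Finset.mul_sum, Finset.sum_add_distrib]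
          rw [sum_flipAt k (fun b => err b k), sum_flipAt k (fun b => T b k)]
          rw [Finset.sum_const, Finset.card_univ, hcard, nsmul_eq_mul, ← two_mul, ← two_mul,
            ← mul_assoc, ENNReal.div_mul_cancel (by norm_num) (by norm_num)]
          push_cast
          rfl
      _ = 2 * E + N * 2 ^ N * (1 / 2) + κ * ∑ b, ∑ k, T b k := by
          simp_rw [Finset.sum_add_distrib, ← Finset.mul_sum]
          rw [Finset.sum_comm, Finset.sum_comm (f := fun k b => T b k), Finset.sum_const,
            Finset.card_univ, nsmul_eq_mul, mul_assoc]
          simp only [hE, hN]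
          ring
      _ ≤ 2 * E + N * 2 ^ N * (1 / 2) + κ * ∑ b : ι → Bool, (n : ℝ≥0∞) := by
          gcongr with b
          exact A.sum_visitProb_le (P b) w hc n
      _ = _ := by
          rw [Finset.sum_const, Finset.card_univ, hcard, nsmul_eq_mul]
          push_cast
          ring
  -- A success leaves at most `N / 32` wrong bits, a failure at most `N`.
  have hup : 32 * E + 31 * (N * s) ≤ 32 * (N * 2 ^ N) := by
    have hb : ∀ b, 32 * ∑ k, err b k + 31 * (N * (p b).toOuterMeasure (S b)) ≤ 32 * N := by
      intro b
      rw [PMF.toOuterMeasure_apply]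
      simp only [herr]
      rw [← Summable.tsum_finsetSum (fun _ _ => ENNReal.summable), ← ENNReal.tsum_mul_left,
        ← ENNReal.tsum_mul_left, ← ENNReal.tsum_mul_left, ← ENNReal.tsum_add]
      calc _ ≤ ∑' h, p b h * (32 * N) := by
            refine ENNReal.tsum_le_tsum fun h => ?_
            rw [← Finset.mul_sum, Finset.sum_boole]
            by_cases hb : h ∈ S b
            · rw [indicator_of_mem hb]
              have := hest' h b hb
              have h2 : (32 * (Finset.univ.filter fun k => est h k ≠ b k).card : ℝ≥0∞) ≤ N := by
                exact_mod_cast this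
              calc _ = p b h * (32 * ((Finset.univ.filter fun k => est h k ≠ b k).card : ℝ≥0∞)
                    + 31 * N) := by ring
                _ ≤ p b h * (N + 31 * N) := by gcongr
                _ = _ := by ring
            · rw [indicator_of_notMem hb, mul_zero, mul_zero, add_zero, mul_left_comm]
              gcongr
              exact_mod_cast Finset.card_le_univ _
        _ = 32 * N := by rw [ENNReal.tsum_mul_right, (p b).tsum_coe, one_mul]
    calc 32 * E + 31 * (N * s)
        = ∑ b, (32 * ∑ k, err b k + 31 * (N * (p b).toOuterMeasure (S b))) := by
          rw [Finset.sum_add_distrib, hE, hs, Finset.mul_sum, Finset.mul_sum, Finset.mul_sum]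
      _ ≤ ∑ b : ι → Bool, 32 * (N : ℝ≥0∞) := Finset.sum_le_sum fun b _ => hb b
      _ = _ := by
          rw [Finset.sum_const, Finset.card_univ, hcard, nsmul_eq_mul]
          push_cast
          ring
  have hN0 : 0 < N := Fintype.card_pos
  have hE_ne : E ≠ ⊤ := by
    intro h
    rw [h] at hup
    simp at hup
    exact absurd hup (by finiteness)
  have hs_ne : s ≠ ⊤ := by
    intro h
    rw [h, ENNReal.mul_top (by exact_mod_cast hN0.ne')] at hup
    simp at hup
    exact absurd hup (by finiteness)
  have hκ : 4 * (κ * (n * 2 ^ N)) ≤ N * 2 ^ N := by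
    calc 4 * (κ * (n * 2 ^ N)) = 4 * (κ * n) * 2 ^ N := by ring
      _ ≤ N * 2 ^ N := by gcongr
  generalize κ * (n * 2 ^ N) = M at hκ hlow
  have hM_ne : M ≠ ⊤ := by
    intro h
    rw [h] at hκ
    simp at hκ
    exact absurd hκ (by finiteness)
  clear_value E s
  lift M to NNReal using hM_ne
  lift s to NNReal using hs_ne
  lift E to NNReal using hE_ne
  have hhalf : (1 / 2 : ℝ≥0∞) = ((1 / 2 : NNReal) : ℝ≥0∞) := by
    rw [ENNReal.coe_div (by norm_num)]; simp
  rw [hhalf] at hlow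
  norm_cast at hκ hlow hup ⊢
  rw [← NNReal.coe_le_coe] at hκ hlow hup ⊢
  push_cast at hκ hlow hup ⊢
  have hNR : (0 : ℝ) < N := by exact_mod_cast hN0
  -- With `4 * κ * n ≤ N`, `hlow` gives `E ≥ N * 2 ^ N / 8`; inserted in `hup` this leaves `31 * s ≤
  -- (32 - 4) * 2 ^ N`.
  nlinarith

/-! ### Stopped histories and averaging over seeds -/

theorem ActiveLearner.toOuterMeasure_history_mono (A : ActiveLearner.{u} d) (P : ResponseLaw d)
    (w : A.Seed) {S : Set (List Response)} (hS : ∀ h ∈ S, A.halt h w) :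
    Monotone fun n => (A.history P w n).toOuterMeasure S := by
  refine monotone_nat_of_le_succ fun n => ?_
  rw [A.history_succ, PMF.toOuterMeasure_bind_apply, PMF.toOuterMeasure_apply]
  refine ENNReal.tsum_le_tsum fun h => ?_
  by_cases hh : h ∈ S
  -- A halted history is frozen, so it keeps its mass in the next round.
  · simp [ActiveLearner.step, hS h hh, hh]
  · simp [hh]

theorem ActiveLearner.successProb_mono (A : ActiveLearner.{u} d) (P : ResponseLaw d)
    (g : BasePoint d → ℝ) (ε : ℝ) : Monotone (A.successProb P g ε) := by
  intro m n hmn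
  exact lintegral_mono fun w => A.toOuterMeasure_history_mono P w (fun h hh => hh.1) hmn

/-- Only superadditivity of the lower integral is used, so the success events need not be shown
measurable in the seed. -/
theorem sum_lintegral_le_lintegral_sum {Ω ι : Type*} [MeasurableSpace Ω] (μ : Measure Ω)
    (s : Finset ι) (f : ι → Ω → ℝ≥0∞) :
    ∑ i ∈ s, ∫⁻ w, f i w ∂μ ≤ ∫⁻ w, ∑ i ∈ s, f i w ∂μ := by
  classical
  induction s using Finset.induction_on with
  | empty => simp
  | insert a s ha ih =>
    simp_rw [Finset.sum_insert ha]
    refine (add_le_add_right ih _).trans ?_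
    exact le_lintegral_add _ _

end AbstainingLabeler

end

noncomputable section

namespace AbstainingLabeler

/-! ### Taylor remainders -/

section Taylor

variable {E : Type*} [NormedAddCommGroup E] [NormedSpace ℝ E]

theorem abs_taylor_remainder_le {F : E → ℝ} {n : ℕ} (hF : ContDiff ℝ (n + 1) F) {A : ℝ}
    (hA : ∀ z, ‖iteratedFDeriv ℝ (n + 1) F z‖ ≤ A) (x y : E) :
    |F y - ∑ m ∈ Finset.range (n + 1),
        iteratedFDeriv ℝ m F x (fun _ => y - x) / (m.factorial : ℝ)| ≤ A * ‖y - x‖ ^ (n + 1) := by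
  have hT := map_add_eq_sum_add_integral_iteratedFDeriv (f := F) (x := x) (y := y - x) (n := n)
    (fun t _ => hF.contDiffAt)
  rw [add_sub_cancel] at hT
  have hA0 : 0 ≤ A := (norm_nonneg _).trans (hA x)
  have hsum : ∑ m ∈ Finset.range (n + 1),
        iteratedFDeriv ℝ m F x (fun _ => y - x) / (m.factorial : ℝ)
      = ∑ m ∈ Finset.range (n + 1),
        (m.factorial : ℝ)⁻¹ • iteratedFDeriv ℝ m F x (fun _ => y - x) :=
    Finset.sum_congr rfl fun m _ => by rw [smul_eq_mul, div_eq_inv_mul]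
  rw [hsum, hT, add_sub_cancel_left, ← Real.norm_eq_abs, norm_smul]
  have hint : ‖∫ t in (0 : ℝ)..1, (1 - t) ^ n •
      iteratedFDeriv ℝ (n + 1) F (x + t • (y - x)) (fun _ => y - x)‖
        ≤ A * ‖y - x‖ ^ (n + 1) * |(1 : ℝ) - 0| := by
    refine intervalIntegral.norm_integral_le_of_norm_le_const fun t ht => ?_
    rw [uIoc_of_le zero_le_one] at ht
    rw [norm_smul]
    have h1 : ‖(1 - t) ^ n‖ ≤ 1 := by
      rw [norm_pow]
      refine pow_le_one₀ (norm_nonneg _) ?_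
      rw [Real.norm_eq_abs, abs_le]
      constructor <;> linarith [ht.1, ht.2]
    have h2 : ‖iteratedFDeriv ℝ (n + 1) F (x + t • (y - x)) (fun _ => y - x)‖
        ≤ A * ‖y - x‖ ^ (n + 1) := by
      refine (ContinuousMultilinearMap.le_opNorm _ _).trans ?_
      rw [Finset.prod_const, Finset.card_univ, Fintype.card_fin]
      gcongr
      exact hA _
    calc _ ≤ 1 * (A * ‖y - x‖ ^ (n + 1)) := by gcongr
      _ = _ := one_mul _
  have hfac : ‖((n.factorial : ℝ))⁻¹‖ ≤ 1 := by
    rw [norm_inv, Real.norm_natCast]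
    exact inv_le_one_of_one_le₀ (by exact_mod_cast n.factorial_pos)
  calc _ ≤ 1 * (A * ‖y - x‖ ^ (n + 1) * |(1 : ℝ) - 0|) := by gcongr
    _ = _ := by simp

/-- Interpolation at the scale `s = M * ‖y - x‖`. For `s ≤ 1` the remainder of order `⌊γ⌋₊ + 1`
gives `s ^ (⌊γ⌋₊ + 1) ≤ s ^ γ`. For `s ≥ 1` the top Taylor term is split off and bounded separately,
giving twice `s ^ ⌊γ⌋₊ ≤ s ^ γ`. -/
theorem abs_taylor_remainder_le_rpow {F : E → ℝ} {γ : ℝ} (hγ : 1 ≤ γ)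
    (hF : ContDiff ℝ (⌊γ⌋₊ + 1 : ℕ) F) {A M : ℝ} (hM : 0 ≤ M)
    (h0 : ∀ z, ‖iteratedFDeriv ℝ ⌊γ⌋₊ F z‖ ≤ A * M ^ ⌊γ⌋₊)
    (h1 : ∀ z, ‖iteratedFDeriv ℝ (⌊γ⌋₊ + 1) F z‖ ≤ A * M ^ (⌊γ⌋₊ + 1)) (hA : 0 ≤ A) (x y : E) :
    |F y - ∑ m ∈ Finset.range (⌊γ⌋₊ + 1),
        iteratedFDeriv ℝ m F x (fun _ => y - x) / (m.factorial : ℝ)|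
      ≤ 2 * A * M ^ γ * ‖y - x‖ ^ γ := by
  have hl1 : 1 ≤ ⌊γ⌋₊ := by rwa [Nat.one_le_floor_iff]
  have hfl : (⌊γ⌋₊ : ℝ) ≤ γ := Nat.floor_le (by linarith)
  have hfu : γ ≤ (⌊γ⌋₊ + 1 : ℕ) := by push_cast; exact (Nat.lt_floor_add_one γ).le
  have hup := abs_taylor_remainder_le (by exact_mod_cast hF) h1 x y
  generalize ⌊γ⌋₊ = l at *
  obtain ⟨n, rfl⟩ : ∃ n, l = n + 1 := ⟨l - 1, by omega⟩
  have hlow := abs_taylor_remainder_le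
    ((hF.of_le (by norm_cast; omega) : ContDiff ℝ (n + 1 : ℕ) F)) h0 x y
  have hterm : |iteratedFDeriv ℝ (n + 1) F x (fun _ => y - x) / ((n + 1).factorial : ℝ)|
      ≤ A * M ^ (n + 1) * ‖y - x‖ ^ (n + 1) := by
    rw [abs_div, Nat.abs_cast]
    refine (div_le_self (abs_nonneg _) (by exact_mod_cast (n + 1).factorial_pos)).trans ?_
    rw [← Real.norm_eq_abs]
    refine (ContinuousMultilinearMap.le_opNorm _ _).trans ?_
    rw [Finset.prod_const, Finset.card_univ, Fintype.card_fin]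
    gcongr
    exact h0 x
  rw [mul_assoc (2 * A), ← Real.mul_rpow hM (norm_nonneg _)]
  rw [mul_assoc, ← mul_pow] at hup hlow hterm
  have hs0 : 0 ≤ M * ‖y - x‖ := by positivity
  generalize M * ‖y - x‖ = s at *
  rcases le_total s 1 with hs | hs
  · refine hup.trans ?_
    have h : s ^ (n + 1 + 1) ≤ s ^ γ := by
      rw [← Real.rpow_natCast]
      exact Real.rpow_le_rpow_of_exponent_ge' hs0 hs (by linarith) hfu
    have : 0 ≤ s ^ γ := Real.rpow_nonneg hs0 _
    nlinarith
  · rw [Finset.sum_range_succ, ← sub_sub]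
    refine (abs_sub _ _).trans ((add_le_add hlow hterm).trans ?_)
    have h : s ^ (n + 1) ≤ s ^ γ := by
      rw [← Real.rpow_natCast]
      exact Real.rpow_le_rpow_of_exponent_le hs hfl
    nlinarith

end Taylor

/-! ### Boundaries with bumps on a grid -/

theorem sum_le_of_subsingleton_support {ι : Type*} [Fintype ι] {f : ι → ℝ} {B : ℝ} (hB : 0 ≤ B)
    (hf : ∀ k, f k ≤ B) (hs : ∀ k k', f k ≠ 0 → f k' ≠ 0 → k = k') : ∑ k, f k ≤ B := by
  by_cases h : ∃ k, f k ≠ 0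
  · obtain ⟨k, hk⟩ := h
    rw [Finset.sum_eq_single k (fun k' _ hk' => by_contra fun h => hk' (hs _ _ h hk)) (by simp)]
    exact hf k
  · push Not at h
    simpa [h] using hB

section Bumps

variable {D m : ℕ}

/-- The center of the unit cube. -/
def cubeCenter (D : ℕ) : EuclideanSpace ℝ (Fin D) := WithLp.toLp 2 fun _ => 1 / 2

/-- A smooth bump supported inside the unit cube. -/
def unitBump (D : ℕ) : ContDiffBump (cubeCenter D) where
  rIn := 1 / 4
  rOut := 3 / 8
  rIn_pos := by norm_num
  rIn_lt_rOut := by norm_num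

/-- The corner of the grid cell with index `k`. -/
def gridCorner (k : Fin D → Fin m) : EuclideanSpace ℝ (Fin D) :=
  WithLp.toLp 2 fun i => ((k i : ℕ) : ℝ)

theorem abs_apply_sub_half_le (z : EuclideanSpace ℝ (Fin D)) (k : Fin D → Fin m) (i : Fin D) :
    |z i - (k i : ℕ) - 1 / 2| ≤ dist (z - gridCorner k) (cubeCenter D) := by
  rw [dist_eq_norm]
  have := PiLp.norm_apply_le (z - gridCorner k - cubeCenter D) i
  simpa [gridCorner, cubeCenter] using this

/-- The Euclidean distance dominates every coordinate, so each `z i` lies strictly between `k i` and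
`k i + 1`, and likewise for `k'`. -/
theorem eq_of_dist_lt_half {z : EuclideanSpace ℝ (Fin D)} {k k' : Fin D → Fin m}
    (h : dist (z - gridCorner k) (cubeCenter D) < 1 / 2)
    (h' : dist (z - gridCorner k') (cubeCenter D) < 1 / 2) : k = k' := by
  funext i
  have h1 := abs_lt.1 ((abs_apply_sub_half_le z k i).trans_lt h)
  have h2 := abs_lt.1 ((abs_apply_sub_half_le z k' i).trans_lt h')
  have h3 : ((k i : ℕ) : ℝ) < (k' i : ℕ) + 1 := by linarith
  have h4 : ((k' i : ℕ) : ℝ) < (k i : ℕ) + 1 := by linarith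
  norm_cast at h3 h4
  exact Fin.ext (by omega)

theorem dist_lt_of_unitBump_ne_zero {z : EuclideanSpace ℝ (Fin D)} {k : Fin D → Fin m}
    (h : unitBump D (z - gridCorner k) ≠ 0) :
    dist (z - gridCorner k) (cubeCenter D) < 1 / 2 := by
  have : z - gridCorner k ∈ Function.support (unitBump D) := h
  rw [(unitBump D).support_eq, Metric.mem_ball] at this
  exact this.trans (by norm_num [unitBump])

/-- Derivatives are controlled only by the closed support; the outer radius `3 / 8`, strictly below
`1 / 2`, leaves room for it. -/
theorem dist_lt_of_iteratedFDeriv_unitBump_ne_zero {j : ℕ} {z : EuclideanSpace ℝ (Fin D)}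
    {k : Fin D → Fin m} (h : iteratedFDeriv ℝ j (unitBump D) (z - gridCorner k) ≠ 0) :
    dist (z - gridCorner k) (cubeCenter D) < 1 / 2 := by
  have : z - gridCorner k ∈ tsupport (unitBump D) := support_iteratedFDeriv_subset j h
  rw [(unitBump D).tsupport_eq, Metric.mem_closedBall] at this
  exact this.trans_lt (by norm_num [unitBump])

/-- The sum of the bumps over the grid cells selected by `b`, at unit scale. -/
def bumpSum (b : (Fin D → Fin m) → Bool) (z : EuclideanSpace ℝ (Fin D)) : ℝ :=
  ∑ k, if b k then unitBump D (z - gridCorner k) else 0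

theorem bumpSum_nonneg (b : (Fin D → Fin m) → Bool) (z : EuclideanSpace ℝ (Fin D)) :
    0 ≤ bumpSum b z :=
  Finset.sum_nonneg fun k _ => by split_ifs <;> simp [(unitBump D).nonneg]

theorem bumpSum_le_one (b : (Fin D → Fin m) → Bool) (z : EuclideanSpace ℝ (Fin D)) :
    bumpSum b z ≤ 1 := by
  refine sum_le_of_subsingleton_support zero_le_one
    (fun k => by split_ifs <;> simp [(unitBump D).le_one]) fun k k' hk hk' => ?_
  simp only [ne_eq, ite_eq_right_iff, Classical.not_imp] at hk hk'
  exact eq_of_dist_lt_half (dist_lt_of_unitBump_ne_zero hk.2) (dist_lt_of_unitBump_ne_zero hk'.2)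

theorem bumpSum_eq {b : (Fin D → Fin m) → Bool} {z : EuclideanSpace ℝ (Fin D)}
    {k : Fin D → Fin m} (h : dist (z - gridCorner k) (cubeCenter D) < 1 / 4) :
    bumpSum b z = if b k then 1 else 0 := by
  unfold bumpSum
  rw [Finset.sum_eq_single k]
  · rw [(unitBump D).one_of_mem_closedBall (Metric.mem_closedBall.2 h.le)]
  · intro k' _ hk'
    by_contra h0
    simp only [ite_eq_right_iff, Classical.not_imp] at h0
    exact hk' (eq_of_dist_lt_half (dist_lt_of_unitBump_ne_zero h0.2) (by linarith))
  · simp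

theorem bumpSum_flipAt {b : (Fin D → Fin m) → Bool} {z : EuclideanSpace ℝ (Fin D)}
    {k : Fin D → Fin m} (h : unitBump D (z - gridCorner k) = 0) :
    bumpSum (flipAt k b) z = bumpSum b z := by
  refine Finset.sum_congr rfl fun k' _ => ?_
  by_cases hk : k' = k
  · subst hk
    simp [h]
  · simp [flipAt, hk]

theorem contDiff_bumpSum {n : ℕ} (b : (Fin D → Fin m) → Bool) : ContDiff ℝ n (bumpSum b) := by
  unfold bumpSum
  refine ContDiff.sum fun k _ => ?_
  split_ifs
  · exact (unitBump D).contDiff.comp (contDiff_id.sub contDiff_const)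
  · exact contDiff_const

/-- The bound is uniform in `m` and `b` because at most one bump has a nonzero derivative at any
point, so it is the bound for a single compactly supported bump. -/
theorem exists_norm_iteratedFDeriv_bumpSum_le (D j : ℕ) :
    ∃ B : ℝ, 0 ≤ B ∧ ∀ (m : ℕ) (b : (Fin D → Fin m) → Bool) (z : EuclideanSpace ℝ (Fin D)),
      ‖iteratedFDeriv ℝ j (bumpSum b) z‖ ≤ B := by
  have hsm : ContDiff ℝ j (unitBump D) := (unitBump D).contDiff
  obtain ⟨B, hB⟩ := (hsm.continuous_iteratedFDeriv (le_refl _)).bounded_above_of_compact_support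
    ((unitBump D).hasCompactSupport.iteratedFDeriv (𝕜 := ℝ) j)
  refine ⟨B, (norm_nonneg _).trans (hB 0), fun m b z => ?_⟩
  have hB0 : 0 ≤ B := (norm_nonneg _).trans (hB 0)
  have hk : ∀ k, ContDiff ℝ j
      fun z : EuclideanSpace ℝ (Fin D) => if b k then unitBump D (z - gridCorner k) else 0 := by
    intro k
    split_ifs
    · exact (unitBump D).contDiff.comp (contDiff_id.sub contDiff_const)
    · exact contDiff_const
  have hsum : iteratedFDeriv ℝ j (bumpSum b) z = ∑ k, iteratedFDeriv ℝ j
      (fun z => if b k then unitBump D (z - gridCorner k) else 0) z := by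
    unfold bumpSum
    exact iteratedFDeriv_fun_sum_apply fun k _ => (hk k).contDiffAt
  have hterm : ∀ k, iteratedFDeriv ℝ j
      (fun z => if b k then unitBump D (z - gridCorner k) else 0) z
        = if b k then iteratedFDeriv ℝ j (unitBump D) (z - gridCorner k) else 0 := by
    intro k
    split_ifs
    · exact iteratedFDeriv_comp_sub j _ _
    · exact congrFun iteratedFDeriv_fun_zero z
  rw [hsum]
  refine (norm_sum_le _ _).trans ?_
  refine sum_le_of_subsingleton_support hB0 (fun k => ?_) fun k k' h h' => ?_
  · rw [hterm]
    split_ifs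
    · exact hB _
    · simpa using hB0
  · rw [hterm, norm_ne_zero_iff] at h h'
    simp only [ne_eq, ite_eq_right_iff, Classical.not_imp] at h h'
    exact eq_of_dist_lt_half (dist_lt_of_iteratedFDeriv_unitBump_ne_zero h.2)
      (dist_lt_of_iteratedFDeriv_unitBump_ne_zero h'.2)

/-- The constant boundary `1 / 2` raised by bumps of height `η` over the cells of the grid of
mesh `1 / m` selected by `b`. -/
def bumpBoundary (η : ℝ) (b : (Fin D → Fin m) → Bool) (x : EuclideanSpace ℝ (Fin D)) : ℝ :=
  1 / 2 + η * bumpSum b ((m : ℝ) • x)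

theorem contDiff_bumpBoundary {n : ℕ} (η : ℝ) (b : (Fin D → Fin m) → Bool) :
    ContDiff ℝ n (bumpBoundary η b) :=
  contDiff_const.add (contDiff_const.mul ((contDiff_bumpSum b).comp (contDiff_const_smul _)))

theorem bumpBoundary_mem_Icc {η : ℝ} (hη : 0 ≤ η) (b : (Fin D → Fin m) → Bool)
    (x : EuclideanSpace ℝ (Fin D)) : bumpBoundary η b x ∈ Icc (1 / 2) (1 / 2 + η) := by
  unfold bumpBoundary
  have h0 := bumpSum_nonneg b ((m : ℝ) • x)
  have h1 := bumpSum_le_one b ((m : ℝ) • x)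
  constructor <;> nlinarith

theorem norm_iteratedFDeriv_bumpBoundary_le {η B : ℝ} (hη : 0 ≤ η) {j : ℕ} (hj : j ≠ 0)
    {b : (Fin D → Fin m) → Bool} (hB : ∀ z, ‖iteratedFDeriv ℝ j (bumpSum b) z‖ ≤ B)
    (x : EuclideanSpace ℝ (Fin D)) :
    ‖iteratedFDeriv ℝ j (bumpBoundary η b) x‖ ≤ η * B * (m : ℝ) ^ j := by
  have hs : ContDiff ℝ j fun x => bumpSum b ((m : ℝ) • x) :=
    (contDiff_bumpSum b).comp (contDiff_const_smul _)
  have h : iteratedFDeriv ℝ j (bumpBoundary η b) x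
      = η • (m : ℝ) ^ j • iteratedFDeriv ℝ j (bumpSum b) ((m : ℝ) • x) := by
    have h1 : bumpBoundary η b
        = (fun _ => (1 / 2 : ℝ)) + η • fun x => bumpSum b ((m : ℝ) • x) := by
      funext x
      simp [bumpBoundary]
    have hs' : ContDiff ℝ j (η • fun x => bumpSum b ((m : ℝ) • x)) := hs.const_smul η
    rw [h1, iteratedFDeriv_add_apply contDiff_const.contDiffAt hs'.contDiffAt,
      iteratedFDeriv_const_of_ne hj, iteratedFDeriv_const_smul_apply hs.contDiffAt,
      iteratedFDeriv_comp_const_smul _ (contDiff_bumpSum b)]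
    simp
  rw [h, norm_smul, norm_smul, Real.norm_of_nonneg hη, norm_pow, Real.norm_natCast]
  have := hB ((m : ℝ) • x)
  calc _ ≤ η * ((m : ℝ) ^ j * B) := by gcongr
    _ = _ := by ring

end Bumps

variable {d m : ℕ}

theorem ball_cubeCenter_subset_baseCube :
    Metric.ball (cubeCenter (d - 1)) (1 / 2) ⊆ baseCube d := by
  intro x hx i
  have h := PiLp.norm_apply_le (x - cubeCenter (d - 1)) i
  rw [Metric.mem_ball, dist_eq_norm] at hx
  have h2 := abs_lt.1 (h.trans_lt hx)
  simp only [cubeCenter, PiLp.sub_apply] at h2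
  constructor <;> linarith [h2.1, h2.2]

theorem convex_baseCube : Convex ℝ (baseCube d) := by
  intro x hx y hy a b ha hb hab i
  exact convex_Icc (0 : ℝ) 1 (hx i) (hy i) ha hb hab

theorem uniqueDiffOn_baseCube : UniqueDiffOn ℝ (baseCube d) := by
  refine uniqueDiffOn_convex convex_baseCube ⟨cubeCenter (d - 1), ?_⟩
  exact mem_interior.2 ⟨_, ball_cubeCenter_subset_baseCube, Metric.isOpen_ball,
    Metric.mem_ball_self (by norm_num)⟩

theorem isClosed_baseCube : IsClosed (baseCube d) := by
  have : baseCube d = ⋂ i, (fun x : EuclideanSpace ℝ (Fin (d - 1)) => x i) ⁻¹' Icc 0 1 := by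
    ext x
    simp [baseCube]
  rw [this]
  exact isClosed_iInter fun i => isClosed_Icc.preimage (by fun_prop)

/-- The restriction of `bumpBoundary` to the cube. -/
def cubeBoundary (η : ℝ) (b : (Fin (d - 1) → Fin m) → Bool) (x : BasePoint d) : ℝ :=
  bumpBoundary η b x

theorem exists_cubeBoundary_mem_smoothBoundaries (d : ℕ) {γ : ℝ} (hγ : 1 ≤ γ) :
    ∃ B : ℝ, 0 < B ∧ ∀ (m : ℕ) (K η : ℝ) (b : (Fin (d - 1) → Fin m) → Bool), 0 ≤ η →
      η ≤ 1 / 4 → B * η * (m : ℝ) ^ γ ≤ K → cubeBoundary η b ∈ smoothBoundaries d K γ := by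
  obtain ⟨B₀, hB₀, h₀⟩ := exists_norm_iteratedFDeriv_bumpSum_le (d - 1) ⌊γ⌋₊
  obtain ⟨B₁, hB₁, h₁⟩ := exists_norm_iteratedFDeriv_bumpSum_le (d - 1) (⌊γ⌋₊ + 1)
  -- The factor `2` comes from the interpolated Taylor bound, the sum covers both derivative orders,
  -- and `1` ensures positivity.
  refine ⟨2 * (B₀ + B₁ + 1), by positivity, fun m K η b hη hη' hK => ⟨fun x => ?_, ?_⟩⟩
  · have := bumpBoundary_mem_Icc hη b x
    exact ⟨by linarith [this.1, show cubeBoundary η b x = bumpBoundary η b x from rfl],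
      by linarith [this.2, show cubeBoundary η b x = bumpBoundary η b x from rfl]⟩
  · refine ⟨bumpBoundary η b, fun _ => rfl, (contDiff_bumpBoundary η b).contDiffOn,
      fun x hx y _ => ?_⟩
    have hl : ⌊γ⌋₊ ≠ 0 := (Nat.floor_pos.2 hγ).ne'
    have hd : ∀ j, iteratedFDerivWithin ℝ j (bumpBoundary η b) (baseCube d) x
        = iteratedFDeriv ℝ j (bumpBoundary η b) x := fun j =>
      iteratedFDerivWithin_eq_iteratedFDeriv uniqueDiffOn_baseCube
        (contDiff_bumpBoundary η b).contDiffAt hx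
    simp_rw [hd]
    refine (abs_taylor_remainder_le_rpow hγ (contDiff_bumpBoundary η b)
      (A := η * (B₀ + B₁ + 1)) (M := m) (by positivity) (fun z => ?_) (fun z => ?_)
      (by positivity) x y).trans ?_
    · exact norm_iteratedFDeriv_bumpBoundary_le hη hl
        (fun z => (h₀ m b z).trans (by linarith)) z
    · exact norm_iteratedFDeriv_bumpBoundary_le hη (Nat.succ_ne_zero _)
        (fun z => (h₁ m b z).trans (by linarith)) z
    · gcongr
      refine le_trans (le_of_eq ?_) hK
      ring

theorem cubeBoundary_flipAt {η : ℝ} {b : (Fin (d - 1) → Fin m) → Bool} {x : BasePoint d}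
    {k : Fin (d - 1) → Fin m}
    (h : unitBump (d - 1) ((m : ℝ) • (x : EuclideanSpace ℝ (Fin (d - 1))) - gridCorner k) = 0) :
    cubeBoundary η (flipAt k b) x = cubeBoundary η b x := by
  simp only [cubeBoundary, bumpBoundary, bumpSum_flipAt h]

/-! ### Separation of the boundaries -/

/-- The volume of a ball of radius `1 / 4`. -/
def quarterBallVolume (D : ℕ) : ℝ≥0∞ :=
  volume (Metric.ball (0 : EuclideanSpace ℝ (Fin D)) (1 / 4))

/-- The part of the grid cell `k` on which its bump equals one. -/
def plateau {D : ℕ} (k : Fin D → Fin m) : Set (EuclideanSpace ℝ (Fin D)) :=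
  Metric.ball ((m : ℝ)⁻¹ • (gridCorner k + cubeCenter D)) ((m : ℝ)⁻¹ * (1 / 4))

theorem dist_lt_of_mem_plateau {D : ℕ} (hm : 0 < m) {k : Fin D → Fin m}
    {x : EuclideanSpace ℝ (Fin D)} (hx : x ∈ plateau k) :
    dist ((m : ℝ) • x - gridCorner k) (cubeCenter D) < 1 / 4 := by
  have hm' : (0 : ℝ) < m := by exact_mod_cast hm
  rw [plateau, Metric.mem_ball, dist_eq_norm] at hx
  rw [dist_eq_norm, sub_sub]
  have h : (m : ℝ) • x - (gridCorner k + cubeCenter D)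
      = (m : ℝ) • (x - (m : ℝ)⁻¹ • (gridCorner k + cubeCenter D)) := by
    rw [smul_sub, smul_inv_smul₀ hm'.ne']
  rw [h, norm_smul, Real.norm_natCast]
  calc _ < (m : ℝ) * ((m : ℝ)⁻¹ * (1 / 4)) := by gcongr
    _ = 1 / 4 := by field_simp

theorem plateau_subset_baseCube (hm : 0 < m) (k : Fin (d - 1) → Fin m) :
    plateau k ⊆ baseCube d := by
  intro x hx i
  have hm' : (0 : ℝ) < m := by exact_mod_cast hm
  have h := abs_lt.1 ((abs_apply_sub_half_le ((m : ℝ) • x) k i).trans_lt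
    (dist_lt_of_mem_plateau hm hx))
  simp only [PiLp.smul_apply, smul_eq_mul] at h
  have hk : ((k i : ℕ) : ℝ) + 1 ≤ m := by exact_mod_cast (k i).isLt
  have hk0 : (0 : ℝ) ≤ (k i : ℕ) := Nat.cast_nonneg _
  constructor
  · by_contra! hneg
    nlinarith [mul_neg_of_pos_of_neg hm' hneg]
  · by_contra! hgt
    nlinarith [mul_lt_mul_of_pos_left hgt hm']

theorem disjoint_plateau {D : ℕ} (hm : 0 < m) {k k' : Fin D → Fin m} (h : k ≠ k') :
    Disjoint (plateau k) (plateau k') := by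
  rw [Set.disjoint_left]
  intro x hx hx'
  exact h (eq_of_dist_lt_half ((dist_lt_of_mem_plateau hm hx).trans (by norm_num))
    ((dist_lt_of_mem_plateau hm hx').trans (by norm_num)))

theorem volume_plateau {D : ℕ} (hm : 0 < m) (k : Fin D → Fin m) :
    volume (plateau k) = ENNReal.ofReal (((m : ℝ)⁻¹) ^ D) * quarterBallVolume D := by
  have hm' : (0 : ℝ) < (m : ℝ)⁻¹ := by positivity
  rw [plateau, Measure.addHaar_ball_mul_of_pos _ _ hm', finrank_euclideanSpace_fin]
  rfl

/-- On the plateau of each cell where the bits disagree the boundaries differ by exactly `η`, and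
the plateaus are disjoint. -/
theorem card_mul_le_boundaryDist (hm : 0 < m) {η : ℝ} (hη : 0 ≤ η)
    (b b' : (Fin (d - 1) → Fin m) → Bool) :
    ((Finset.univ.filter fun k => b k ≠ b' k).card : ℝ≥0∞) *
      (ENNReal.ofReal η * (ENNReal.ofReal (((m : ℝ)⁻¹) ^ (d - 1)) * quarterBallVolume (d - 1)))
      ≤ boundaryDist (cubeBoundary (d := d) η b) (cubeBoundary η b') := by
  classical
  set s := Finset.univ.filter fun k => b k ≠ b' k with hs
  have h1 : boundaryDist (cubeBoundary (d := d) η b) (cubeBoundary η b')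
      = ∫⁻ x in baseCube d, ENNReal.ofReal |bumpBoundary η b x - bumpBoundary η b' x| :=
    lintegral_subtype_comap isClosed_baseCube.measurableSet
      (fun x => ENNReal.ofReal |bumpBoundary η b x - bumpBoundary η b' x|)
  rw [h1]
  calc _ = ∑ k ∈ s, ∫⁻ x in plateau k, ENNReal.ofReal η := by
        simp_rw [lintegral_const, Measure.restrict_apply_univ, volume_plateau hm]
        rw [Finset.sum_const, nsmul_eq_mul]
    _ = ∑ k ∈ s, ∫⁻ x in plateau k,
          ENNReal.ofReal |bumpBoundary η b x - bumpBoundary η b' x| := by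
        refine Finset.sum_congr rfl fun k hk => setLIntegral_congr_fun
          Metric.isOpen_ball.measurableSet fun x hx => ?_
        have hd := dist_lt_of_mem_plateau hm hx
        simp only [bumpBoundary, bumpSum_eq hd]
        have hne : b k ≠ b' k := (Finset.mem_filter.1 hk).2
        cases hb : b k <;> cases hb' : b' k <;> simp_all [abs_of_nonneg]
    _ = ∫⁻ x in ⋃ k ∈ s, plateau k,
          ENNReal.ofReal |bumpBoundary η b x - bumpBoundary η b' x| := by
        rw [lintegral_biUnion_finset]
        · intro k _ k' _ h
          exact disjoint_plateau hm h
        · exact fun k _ => Metric.isOpen_ball.measurableSet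
    _ ≤ _ := lintegral_mono_set (iUnion₂_subset fun k _ => plateau_subset_baseCube hm k)

end AbstainingLabeler

end

noncomputable section

namespace AbstainingLabeler

/-! ### A noiseless abstaining labeler -/

section Labeler

variable {d : ℕ} {C' α : ℝ}

/-- The probability `C' |x_d - g(x̃)| ^ α` of an answer, truncated to `[0,1]`. -/
def answerProb (C' α : ℝ) (g : BasePoint d → ℝ) (x : InstancePoint d) : ℝ :=
  max 0 (min 1 (C' * gap g x ^ α))

/-- The labeler which answers with probability `answerProb`, always correctly. -/
def noiselessLabeler (C' α : ℝ) (g : BasePoint d → ℝ) : ResponseLaw d := fun x =>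
  PMF.ofFintype
    (fun y : Response => y.elim (ENNReal.ofReal (1 - answerProb C' α g x))
      fun l => if l = trueLabel g x then ENNReal.ofReal (answerProb C' α g x) else 0) (by
    have h0 : 0 ≤ answerProb C' α g x := le_max_left _ _
    have h1 : answerProb C' α g x ≤ 1 := max_le zero_le_one (min_le_left _ _)
    have h : ENNReal.ofReal (1 - answerProb C' α g x) + ENNReal.ofReal (answerProb C' α g x)
        = 1 := by
      rw [← ENNReal.ofReal_add (by linarith) h0, sub_add_cancel, ENNReal.ofReal_one]
    rw [Fintype.sum_option, Fintype.sum_bool]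
    cases trueLabel g x <;> simpa using h)

theorem noiselessLabeler_none (g : BasePoint d → ℝ) (x : InstancePoint d) :
    noiselessLabeler C' α g x none = ENNReal.ofReal (1 - answerProb C' α g x) := rfl

theorem noiselessLabeler_some (g : BasePoint d → ℝ) (x : InstancePoint d) (l : Bool) :
    noiselessLabeler C' α g x (some l)
      = if l = trueLabel g x then ENNReal.ofReal (answerProb C' α g x) else 0 := rfl

theorem gap_nonneg (g : BasePoint d → ℝ) (x : InstancePoint d) : 0 ≤ gap g x := abs_nonneg _

theorem gap_le_one {g : BasePoint d → ℝ} (hg : ∀ x, g x ∈ Icc (0 : ℝ) 1) (x : InstancePoint d) :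
    gap g x ≤ 1 := by
  have h1 := hg x.1
  have h2 := x.2.2
  rw [gap, abs_le]
  constructor <;> linarith [h1.1, h1.2, h2.1, h2.2]

/-- The truncation only makes the labeler total in `g`; for boundaries in `[0,1]` it is inactive. -/
theorem answerProb_eq (hC0 : 0 ≤ C') (hC1 : C' ≤ 1) (hα : 0 ≤ α) {g : BasePoint d → ℝ}
    (hg : ∀ x, g x ∈ Icc (0 : ℝ) 1) (x : InstancePoint d) :
    answerProb C' α g x = C' * gap g x ^ α := by
  have h0 : 0 ≤ gap g x ^ α := Real.rpow_nonneg (gap_nonneg g x) α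
  have h1 : gap g x ^ α ≤ 1 := Real.rpow_le_one (gap_nonneg g x) (gap_le_one hg x) hα
  rw [answerProb, min_eq_right (by nlinarith), max_eq_right (by positivity)]

theorem abstainProb_noiselessLabeler (g : BasePoint d → ℝ) (x : InstancePoint d) :
    abstainProb (noiselessLabeler C' α g) x = 1 - answerProb C' α g x := by
  have h1 : answerProb C' α g x ≤ 1 := max_le zero_le_one (min_le_left _ _)
  rw [abstainProb, noiselessLabeler_none, ENNReal.toReal_ofReal (by linarith)]

theorem noiseRate_noiselessLabeler (g : BasePoint d → ℝ) (x : InstancePoint d) :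
    noiseRate (noiselessLabeler C' α g) g x = 0 := by
  simp [noiseRate, noiselessLabeler_some]

theorem isRate_rpow (hC0 : 0 ≤ C') (hC1 : C' ≤ 1) (hα : 0 ≤ α) :
    IsRate fun x => C' * x ^ α := by
  refine ⟨fun x hx y _ hxy => ?_, fun x hx => ⟨?_, ?_⟩⟩
  · have := Real.rpow_le_rpow hx.1 hxy hα
    exact mul_le_mul_of_nonneg_left this hC0
  · exact mul_nonneg hC0 (Real.rpow_nonneg hx.1 α)
  · exact mul_le_one₀ hC1 (Real.rpow_nonneg hx.1 α) (Real.rpow_le_one hx.1 hx.2 hα)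

theorem condition1_noiselessLabeler (hC0 : 0 ≤ C') (hC1 : C' ≤ 1) (hα : 0 ≤ α)
    {g : BasePoint d → ℝ} (hg : ∀ x, g x ∈ Icc (0 : ℝ) 1) :
    Condition1 (noiselessLabeler C' α g) g := by
  refine ⟨fun t s s' h => ?_, fun x _ => ?_⟩
  · rw [abstainProb_noiselessLabeler, abstainProb_noiselessLabeler,
      answerProb_eq hC0 hC1 hα hg, answerProb_eq hC0 hC1 hα hg]
    have := mul_le_mul_of_nonneg_left (Real.rpow_le_rpow (gap_nonneg g _) h hα) hC0
    linarith
  · rw [noiseRate_noiselessLabeler]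
    norm_num

theorem condition2_noiselessLabeler (hC0 : 0 ≤ C') (hC1 : C' ≤ 1) (hα : 0 ≤ α) {C β : ℝ}
    (hC : 0 ≤ C) (hC' : C ≤ 1) (hβ : 0 ≤ β) {g : BasePoint d → ℝ}
    (hg : ∀ x, g x ∈ Icc (0 : ℝ) 1) :
    Condition2 (fun x => C' * x ^ α) C β (noiselessLabeler C' α g) g := by
  refine ⟨isRate_rpow hC0 hC1 hα, hC, hβ, fun x => ?_, fun x _ => ?_⟩
  · rw [abstainProb_noiselessLabeler, answerProb_eq hC0 hC1 hα hg]
  · rw [noiseRate_noiselessLabeler]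
    have h : C * gap g x ^ β ≤ 1 := mul_le_one₀ hC' (Real.rpow_nonneg (gap_nonneg g x) β)
      (Real.rpow_le_one (gap_nonneg g x) (gap_le_one hg x) hβ)
    linarith

theorem condition3_noiselessLabeler (hC0 : 0 < C') (hC1 : C' ≤ 1) (hα : 0 < α)
    {g : BasePoint d → ℝ} (hg : ∀ x, g x ∈ Icc (0 : ℝ) 1) :
    Condition3 (fun x => C' * x ^ α) (noiselessLabeler C' α g) g := by
  have h23 : (2 / 3 : ℝ) ^ α < 1 := Real.rpow_lt_one (by norm_num) (by norm_num) hα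
  have h23' : (0 : ℝ) < (2 / 3 : ℝ) ^ α := Real.rpow_pos_of_pos (by norm_num) α
  -- By homogeneity the ratio of rates is at most `(2 / 3) ^ α`, hence this choice of constant.
  refine ⟨isRate_rpow hC0.le hC1 hα.le, ⟨1 - (2 / 3 : ℝ) ^ α, by linarith, by linarith,
    fun a ha _ b hb hba => ?_⟩, fun x => ?_⟩
  · have ha' : 0 < C' * a ^ α := mul_pos hC0 (Real.rpow_pos_of_pos ha α)
    refine ⟨ha', ?_⟩
    rw [div_le_iff₀ ha', sub_sub_cancel]
    have h : b ^ α ≤ (2 / 3 : ℝ) ^ α * a ^ α := by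
      rw [← Real.mul_rpow (by norm_num) ha.le]
      exact Real.rpow_le_rpow hb hba hα.le
    calc C' * b ^ α ≤ C' * ((2 / 3 : ℝ) ^ α * a ^ α) := by gcongr
      _ = _ := by ring
  · rw [abstainProb_noiselessLabeler, answerProb_eq hC0.le hC1 hα.le hg]

theorem measurable_of_mem_smoothBoundaries {K γ : ℝ} {g : BasePoint d → ℝ}
    (hg : g ∈ smoothBoundaries d K γ) : Measurable g := by
  obtain ⟨G, hG, hsm, -⟩ := hg.2
  have : g = (baseCube d).domRestrict G := funext fun x => (hG x).symm
  rw [this]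
  exact (continuousOn_iff_continuous_domRestrict.1 hsm.continuousOn).measurable

theorem measurable_noiselessLabeler {g : BasePoint d → ℝ} (hg : Measurable g) (y : Response) :
    Measurable fun x => noiselessLabeler C' α g x y := by
  have hgap : Measurable (gap g) := by
    unfold gap
    exact ((measurable_subtype_coe.comp measurable_snd).sub (hg.comp measurable_fst)).abs
  have hans : Measurable (answerProb C' α g) := by
    unfold answerProb
    fun_prop
  cases y with
  | none =>
    simp_rw [noiselessLabeler_none]
    fun_prop
  | some l =>
    simp_rw [noiselessLabeler_some]
    refine Measurable.ite ?_ (by fun_prop) measurable_const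
    have hset : MeasurableSet {x : InstancePoint d | g x.1 < (x.2 : ℝ)} :=
      measurableSet_lt (hg.comp measurable_fst) (measurable_subtype_coe.comp measurable_snd)
    cases l
    · convert hset.compl using 1
      ext x
      simp [trueLabel]
    · convert hset using 1
      ext x
      simp [trueLabel]

theorem noiselessLabeler_congr {g g' : BasePoint d → ℝ} {x : InstancePoint d}
    (h : g x.1 = g' x.1) : noiselessLabeler C' α g x = noiselessLabeler C' α g' x := by
  have hgap : gap g x = gap g' x := by simp [gap, h]
  have hlab : trueLabel g x = trueLabel g' x := by simp [trueLabel, h]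
  ext y
  cases y <;> simp [noiselessLabeler_none, noiselessLabeler_some, answerProb, hgap, hlab]

/-! ### Hellinger distance between responses for nearby boundaries -/

theorem sqrt_ofReal_mul_ofReal {a b : ℝ} (ha : 0 ≤ a) (hb : 0 ≤ b) :
    (ENNReal.ofReal a * ENNReal.ofReal b) ^ (1 / 2 : ℝ) = ENNReal.ofReal √(a * b) := by
  rw [← ENNReal.ofReal_mul ha, ENNReal.ofReal_rpow_of_nonneg (mul_nonneg ha hb) (by norm_num),
    Real.sqrt_eq_rpow]

/-- One minus the affinity of two Bernoulli laws is half the sum of the squared differences of `√p`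
and of `√(1 - p)`. Keeping `p` and `p'` below `1 - w` makes the second controllable by the first. -/
theorem one_le_sqrt_add_sqrt_add {p p' w t : ℝ} (hp : 0 ≤ p) (hp' : 0 ≤ p') (hw : 0 < w)
    (hpw : p ≤ 1 - w) (hpw' : p' ≤ 1 - w) (ht : (√p - √p') ^ 2 ≤ t) :
    1 ≤ √((1 - p) * (1 - p')) + √(p * p') + t / w := by
  rw [Real.sqrt_mul (by linarith), Real.sqrt_mul hp]
  have ha := Real.sq_sqrt hp
  have ha' := Real.sq_sqrt hp'
  have hu := Real.sq_sqrt (show 0 ≤ 1 - p by linarith)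
  have hu' := Real.sq_sqrt (show 0 ≤ 1 - p' by linarith)
  have ha0 := Real.sqrt_nonneg p
  have ha0' := Real.sqrt_nonneg p'
  have hu0 := Real.sqrt_nonneg (1 - p)
  have hu0' := Real.sqrt_nonneg (1 - p')
  set a := √p
  set a' := √p'
  set u := √(1 - p)
  set u' := √(1 - p')
  have h1 : (u - u') ^ 2 * w ≤ (a - a') ^ 2 := by
    -- Both sides are differences of squares, equal to `p' - p`.
    have e : (u - u') * (u + u') = (a' - a) * (a' + a) := by nlinarith
    have e2 : (u - u') ^ 2 * (u + u') ^ 2 = (a - a') ^ 2 * (a + a') ^ 2 := by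
      rw [← mul_pow, e]; ring
    have h4 : 4 * w ≤ (u + u') ^ 2 := by
      have hmin : w ≤ u * u' := by
        refine (pow_le_pow_iff_left₀ hw.le (mul_nonneg hu0 hu0') two_ne_zero).1 ?_
        rw [mul_pow, hu, hu', sq]
        exact mul_le_mul (by linarith) (by linarith) hw.le (by linarith)
      nlinarith [sq_nonneg (u - u')]
    have h5 : (a + a') ^ 2 ≤ 4 := by
      nlinarith [sq_nonneg (a - a')]
    have h6 := mul_le_mul_of_nonneg_left h4 (sq_nonneg (u - u'))
    have h7 := mul_le_mul_of_nonneg_left h5 (sq_nonneg (a - a'))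
    linarith
  have hw1 : w ≤ 1 := by linarith
  have h2 : (a - a') ^ 2 * w ≤ (a - a') ^ 2 := mul_le_of_le_one_right (sq_nonneg _) hw1
  have h3 : (1 - (u * u' + a * a')) * w ≤ t := by nlinarith
  have := (le_div_iff₀ hw).2 h3
  linarith

theorem abs_rpow_sub_rpow_le {x y p : ℝ} (hx : 0 ≤ x) (hy : 0 ≤ y) (hp : 0 ≤ p) (hp1 : p ≤ 1) :
    |x ^ p - y ^ p| ≤ |x - y| ^ p := by
  wlog h : y ≤ x generalizing x y
  · rw [abs_sub_comm, abs_sub_comm x]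
    exact this hy hx (le_of_not_ge h)
  have h1 := Real.rpow_add_le_add_rpow (sub_nonneg.2 h) hy hp hp1
  rw [sub_add_cancel] at h1
  rw [abs_of_nonneg (sub_nonneg.2 (Real.rpow_le_rpow hy h hp)), abs_of_nonneg (sub_nonneg.2 h)]
  linarith

theorem gap_le_of_trueLabel_ne {g g' : BasePoint d → ℝ} {x : InstancePoint d}
    (h : trueLabel g x ≠ trueLabel g' x) : gap g x ≤ |g x.1 - g' x.1| := by
  simp only [trueLabel, ne_eq, decide_eq_decide] at h
  unfold gap
  by_cases h1 : g x.1 < (x.2 : ℝ)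
  · have h2 : (x.2 : ℝ) ≤ g' x.1 := by
      by_contra! h2
      exact h (by simp [h1, h2])
    rw [abs_of_pos (by linarith), abs_sub_comm, abs_of_nonneg (by linarith)]
    linarith
  · have h2 : g' x.1 < (x.2 : ℝ) := by
      by_contra h2
      exact h (by simp [h1, h2])
    rw [abs_of_nonpos (by linarith), abs_of_nonneg (by linarith)]
    linarith

theorem one_le_affinity_noiselessLabeler_add (hC0 : 0 ≤ C') (hC1 : C' ≤ 1) (hα : 0 < α)
    (hα2 : α ≤ 2) {η : ℝ} {g g' : BasePoint d → ℝ} {x : InstancePoint d}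
    (hg : ∀ x, g x ∈ Icc (1 / 2 : ℝ) (3 / 4)) (hg' : ∀ x, g' x ∈ Icc (1 / 2 : ℝ) (3 / 4))
    (hη : |g x.1 - g' x.1| ≤ η) :
    1 ≤ affinity (noiselessLabeler C' α g x) (noiselessLabeler C' α g' x)
      + ENNReal.ofReal (η ^ α / (1 - (3 / 4) ^ α)) := by
  have hunit : ∀ {f : BasePoint d → ℝ}, (∀ x, f x ∈ Icc (1 / 2 : ℝ) (3 / 4)) →
      ∀ x, f x ∈ Icc (0 : ℝ) 1 := fun hf x =>
    ⟨by linarith [(hf x).1], by linarith [(hf x).2]⟩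
  have hgap : ∀ {f : BasePoint d → ℝ}, (∀ x, f x ∈ Icc (1 / 2 : ℝ) (3 / 4)) →
      gap f x ≤ 3 / 4 := by
    intro f hf
    have h1 := hf x.1
    have h2 := x.2.2
    rw [gap, abs_le]
    constructor <;> linarith [h1.1, h1.2, h2.1, h2.2]
  set w : ℝ := 1 - (3 / 4) ^ α with hw_def
  have hw : 0 < w := by
    have : (3 / 4 : ℝ) ^ α < 1 := Real.rpow_lt_one (by norm_num) (by norm_num) hα
    linarith
  have hw1 : w ≤ 1 := by
    have : (0 : ℝ) ≤ (3 / 4 : ℝ) ^ α := Real.rpow_nonneg (by norm_num) α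
    linarith
  have hη0 : 0 ≤ η := (abs_nonneg _).trans hη
  have hηα : 0 ≤ η ^ α := Real.rpow_nonneg hη0 α
  have hp : answerProb C' α g x = C' * gap g x ^ α :=
    answerProb_eq hC0 hC1 hα.le (hunit hg) x
  have hp' : answerProb C' α g' x = C' * gap g' x ^ α :=
    answerProb_eq hC0 hC1 hα.le (hunit hg') x
  have hle : ∀ {r s : ℝ}, 0 ≤ r → r ≤ s → C' * r ^ α ≤ s ^ α := by
    intro r s hr hrs
    have h1 := Real.rpow_le_rpow hr hrs hα.le
    have h2 := Real.rpow_nonneg hr α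
    nlinarith
  have hpw : C' * gap g x ^ α ≤ 1 - w := by
    simpa [hw_def] using hle (gap_nonneg g x) (hgap hg)
  have hpw' : C' * gap g' x ^ α ≤ 1 - w := by
    simpa [hw_def] using hle (gap_nonneg g' x) (hgap hg')
  have hp0 : 0 ≤ C' * gap g x ^ α := mul_nonneg hC0 (Real.rpow_nonneg (gap_nonneg g x) α)
  have hp0' : 0 ≤ C' * gap g' x ^ α := mul_nonneg hC0 (Real.rpow_nonneg (gap_nonneg g' x) α)
  have haff : affinity (noiselessLabeler C' α g x) (noiselessLabeler C' α g' x)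
      = ENNReal.ofReal √((1 - C' * gap g x ^ α) * (1 - C' * gap g' x ^ α))
        + if trueLabel g x = trueLabel g' x then
            ENNReal.ofReal √((C' * gap g x ^ α) * (C' * gap g' x ^ α)) else 0 := by
    rw [affinity, tsum_fintype, Fintype.sum_option, Fintype.sum_bool]
    simp only [noiselessLabeler_none, noiselessLabeler_some, hp, hp']
    rw [sqrt_ofReal_mul_ofReal (by linarith) (by linarith)]
    congr 1
    have := sqrt_ofReal_mul_ofReal hp0 hp0'
    cases trueLabel g x <;> cases trueLabel g' x <;> simp_all
  have hbound : 1 ≤ √((1 - C' * gap g x ^ α) * (1 - C' * gap g' x ^ α))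
        + (if trueLabel g x = trueLabel g' x then
            √((C' * gap g x ^ α) * (C' * gap g' x ^ α)) else 0) + η ^ α / w := by
    split_ifs with hlab
    -- Equal labels: only the answering probability differs, and its square root is Hölder of
    -- exponent `α / 2 ≤ 1` in the gap.
    · refine one_le_sqrt_add_sqrt_add hp0 hp0' hw hpw hpw' ?_
      have hsq : ∀ r : ℝ, 0 ≤ r → √(C' * r ^ α) = √C' * r ^ (α / 2) := by
        intro r hr
        rw [Real.sqrt_mul hC0, Real.sqrt_eq_rpow (r ^ α), ← Real.rpow_mul hr, mul_one_div]
      rw [hsq _ (gap_nonneg g x), hsq _ (gap_nonneg g' x), ← mul_sub, mul_pow, Real.sq_sqrt hC0,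
        ← sq_abs]
      have h1 : |gap g x ^ (α / 2) - gap g' x ^ (α / 2)| ≤ η ^ (α / 2) := by
        refine (abs_rpow_sub_rpow_le (gap_nonneg g x) (gap_nonneg g' x) (by linarith)
          (by linarith)).trans (Real.rpow_le_rpow (abs_nonneg _) ?_ (by linarith))
        refine (abs_abs_sub_abs_le_abs_sub _ _).trans ?_
        rwa [sub_sub_sub_cancel_left, abs_sub_comm]
      have h2 : (η ^ (α / 2)) ^ 2 = η ^ α := by
        rw [← Real.rpow_natCast, ← Real.rpow_mul hη0]
        congr 1
        push_cast
        ring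
      rw [← h2]
      calc _ ≤ 1 * (η ^ (α / 2)) ^ 2 := by gcongr
        _ = _ := one_mul _
    -- Different labels: the point lies between the boundaries, both answer probabilities are at
    -- most `η ^ α`, and the common abstention alone gives the affinity.
    · have h1 : C' * gap g x ^ α ≤ η ^ α :=
        hle (gap_nonneg g x) ((gap_le_of_trueLabel_ne hlab).trans hη)
      have h2 : C' * gap g' x ^ α ≤ η ^ α := by
        refine hle (gap_nonneg g' x) ((gap_le_of_trueLabel_ne (Ne.symm hlab)).trans ?_)
        rwa [abs_sub_comm]
      have h3 : η ^ α ≤ η ^ α / w := le_div_self hηα hw hw1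
      rcases le_total 1 (η ^ α) with h | h
      · have := Real.sqrt_nonneg ((1 - C' * gap g x ^ α) * (1 - C' * gap g' x ^ α))
        linarith
      · have h4 : 1 - η ^ α ≤ √((1 - C' * gap g x ^ α) * (1 - C' * gap g' x ^ α)) := by
          refine Real.le_sqrt_of_sq_le ?_
          rw [sq]
          exact mul_le_mul (by linarith) (by linarith) (by linarith) (by linarith)
        linarith
  rw [haff, ← ENNReal.ofReal_one]
  refine (ENNReal.ofReal_le_ofReal hbound).trans (le_of_eq ?_)
  rw [ENNReal.ofReal_add (by split_ifs <;> positivity) (by positivity),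
    ENNReal.ofReal_add (by positivity) (by split_ifs <;> positivity)]
  split_ifs <;> simp

end Labeler

end AbstainingLabeler

end

noncomputable section

namespace AbstainingLabeler

/-! ### The lower bound -/

section LowerBound

variable {d m : ℕ}

theorem boundaryDist_le_add {g g' o : BasePoint d → ℝ} (hg : Measurable g) (ho : Measurable o) :
    boundaryDist g g' ≤ boundaryDist o g + boundaryDist o g' := by
  unfold boundaryDist
  rw [← lintegral_add_left (by fun_prop)]
  refine lintegral_mono fun x => ?_
  rw [← ENNReal.ofReal_add (abs_nonneg _) (abs_nonneg _)]
  refine ENNReal.ofReal_le_ofReal ?_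
  rw [abs_sub_comm (o x) (g x)]
  exact abs_sub_le _ _ _

theorem measurable_cubeBoundary (η : ℝ) (b : (Fin (d - 1) → Fin m) → Bool) :
    Measurable (cubeBoundary (d := d) η b) :=
  ((contDiff_bumpBoundary (n := 0) η b).continuous.measurable).comp measurable_subtype_coe

theorem quarterBallVolume_pos (D : ℕ) : 0 < quarterBallVolume D :=
  Metric.measure_ball_pos _ _ (by norm_num)

theorem quarterBallVolume_ne_top (D : ℕ) : quarterBallVolume D ≠ ⊤ :=
  measure_ball_lt_top.ne

/-- The two boundaries are within `2 * ε` of each other, while each differing bit costs `η * v / m ^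
(d - 1)`, with `v` the quarter ball volume; `64 = 2 * 32` yields the fraction `1 / 32`. -/
theorem card_ne_le_of_boundaryDist_le (hm : 0 < m) {η ε : ℝ} (hη : 0 < η) (hε : 0 ≤ ε)
    (hηε : 64 * ε ≤ η * (quarterBallVolume (d - 1)).toReal)
    {b b' : (Fin (d - 1) → Fin m) → Bool} {o : BasePoint d → ℝ} (ho : Measurable o)
    (h : boundaryDist o (cubeBoundary η b) ≤ ENNReal.ofReal ε)
    (h' : boundaryDist o (cubeBoundary η b') ≤ ENNReal.ofReal ε) :
    32 * (Finset.univ.filter fun k => b k ≠ b' k).card ≤ m ^ (d - 1) := by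
  have hv : 0 < (quarterBallVolume (d - 1)).toReal :=
    ENNReal.toReal_pos (quarterBallVolume_pos _).ne' (quarterBallVolume_ne_top _)
  have h1 := (card_mul_le_boundaryDist (d := d) hm hη.le b b').trans
    ((boundaryDist_le_add (measurable_cubeBoundary η b) ho).trans (add_le_add h h'))
  rw [← ENNReal.ofReal_toReal (quarterBallVolume_ne_top (d - 1)),
    ← ENNReal.ofReal_mul (by positivity), ← ENNReal.ofReal_mul hη.le,
    ← ENNReal.ofReal_natCast, ← ENNReal.ofReal_mul (Nat.cast_nonneg _),
    ← ENNReal.ofReal_add hε hε, ENNReal.ofReal_le_ofReal_iff (by positivity)] at h1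
  generalize (Finset.univ.filter fun k => b k ≠ b' k).card = q at h1 ⊢
  generalize (quarterBallVolume (d - 1)).toReal = v at *
  have hM : (0 : ℝ) < (m : ℝ) ^ (d - 1) := by positivity
  rw [inv_pow] at h1
  have h2 : (q : ℝ) * (η * v) ≤ (ε + ε) * (m : ℝ) ^ (d - 1) := by
    have := mul_le_mul_of_nonneg_right h1 hM.le
    refine le_trans (le_of_eq ?_) this
    field_simp
  have h3 : (32 * q : ℝ) * (η * v) ≤ (m : ℝ) ^ (d - 1) * (η * v) := by nlinarith
  have h4 := le_of_mul_le_mul_right h3 (mul_pos hη hv)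
  exact_mod_cast h4

theorem exists_successProb_lt (A : ActiveLearner.{u} d) {C' α : ℝ} (hC0 : 0 ≤ C') (hC1 : C' ≤ 1)
    (hα : 0 < α) (hα2 : α ≤ 2) (hm : 0 < m) {η ε : ℝ} (hη : 0 < η) (hη4 : η ≤ 1 / 4)
    (hε : 0 ≤ ε) (hηε : 64 * ε ≤ η * (quarterBallVolume (d - 1)).toReal) {n : ℕ}
    (hn : 4 * (η ^ α / (1 - (3 / 4) ^ α) * n) ≤ (m : ℝ) ^ (d - 1)) :
    ∃ b : (Fin (d - 1) → Fin m) → Bool,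
      A.successProb (noiselessLabeler C' α (cubeBoundary η b)) (cubeBoundary η b) ε n
        < ENNReal.ofReal (1 - 1 / 16) := by
  have : Nonempty (Fin m) := ⟨⟨0, hm⟩⟩
  have hw : 0 < 1 - (3 / 4 : ℝ) ^ α := by
    have : (3 / 4 : ℝ) ^ α < 1 := Real.rpow_lt_one (by norm_num) (by norm_num) hα
    linarith
  have hκ : 0 ≤ η ^ α / (1 - (3 / 4) ^ α) := by positivity
  set N := Fintype.card (Fin (d - 1) → Fin m) with hN
  have hNm : N = m ^ (d - 1) := by simp [hN]
  set g : ((Fin (d - 1) → Fin m) → Bool) → BasePoint d → ℝ := fun b => cubeBoundary η b with hg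
  have hgmem : ∀ b x, g b x ∈ Icc (1 / 2 : ℝ) (1 / 2 + η) := fun b x =>
    bumpBoundary_mem_Icc hη.le b x
  have hgmem' : ∀ b x, g b x ∈ Icc (1 / 2 : ℝ) (3 / 4) := fun b x =>
    ⟨(hgmem b x).1, by linarith [(hgmem b x).2]⟩
  set c : (Fin (d - 1) → Fin m) → Set (InstancePoint d) := fun k =>
    {x | unitBump (d - 1) ((m : ℝ) • (x.1 : EuclideanSpace ℝ (Fin (d - 1))) - gridCorner k) ≠ 0}
    with hc_def
  have hc : Pairwise fun i j => Disjoint (c i) (c j) := by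
    intro i j hij
    rw [Set.disjoint_left]
    intro x hx hx'
    exact hij (eq_of_dist_lt_half (dist_lt_of_unitBump_ne_zero hx)
      (dist_lt_of_unitBump_ne_zero hx'))
  have hP : ∀ b k x, 1 ≤ affinity (noiselessLabeler C' α (g b) x)
      (noiselessLabeler C' α (g (flipAt k b)) x)
        + (c k).indicator (fun _ => ENNReal.ofReal (η ^ α / (1 - (3 / 4) ^ α))) x := by
    intro b k x
    by_cases hx : x ∈ c k
    · rw [indicator_of_mem hx]
      refine one_le_affinity_noiselessLabeler_add hC0 hC1 hα hα2 (hgmem' _) (hgmem' _) ?_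
      rw [abs_le]
      have h1 := hgmem b x.1
      have h2 := hgmem (flipAt k b) x.1
      constructor <;> linarith [h1.1, h1.2, h2.1, h2.2]
    · have : g b x.1 = g (flipAt k b) x.1 := (cubeBoundary_flipAt (not_not.1 hx)).symm
      rw [noiselessLabeler_congr this, affinity_self]
      exact le_self_add
  have hn' : 4 * (ENNReal.ofReal (η ^ α / (1 - (3 / 4) ^ α)) * n) ≤ N := by
    rw [← ENNReal.ofReal_natCast n, ← ENNReal.ofReal_natCast N, ← ENNReal.ofReal_mul hκ,
      show (4 : ℝ≥0∞) = ENNReal.ofReal 4 by simp, ← ENNReal.ofReal_mul (by norm_num), hNm]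
    refine ENNReal.ofReal_le_ofReal ?_
    exact_mod_cast hn
  have hpoint : ∀ w : A.Seed, 31 * ∑ b, (A.history (noiselessLabeler C' α (g b)) w n).toOuterMeasure
      {h | A.halt h w ∧ boundaryDist (A.output h w) (g b) ≤ ENNReal.ofReal ε}
        ≤ 28 * 2 ^ N := by
    intro w
    refine A.sum_toOuterMeasure_le w (fun b => noiselessLabeler C' α (g b)) hc hP hn'
      (fun b => {h | A.halt h w ∧ boundaryDist (A.output h w) (g b) ≤ ENNReal.ofReal ε})
      fun h b b' hb hb' => ?_
    rw [← hN, hNm]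
    exact card_ne_le_of_boundaryDist_le hm hη hε hηε
      ((A.measurable_output h).comp measurable_prodMk_left) hb.2 hb'.2
  -- Success `15 / 16` at every vertex would contradict the average bound `28 / 31`.
  by_contra! hcon
  have hsum : 31 * ∑ b, A.successProb (noiselessLabeler C' α (g b)) (g b) ε n ≤ 28 * 2 ^ N := by
    calc _ ≤ 31 * ∫⁻ w, ∑ b, (A.history (noiselessLabeler C' α (g b)) w n).toOuterMeasure
          {h | A.halt h w ∧ boundaryDist (A.output h w) (g b) ≤ ENNReal.ofReal ε} ∂A.seedLaw := by
          gcongr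
          exact sum_lintegral_le_lintegral_sum _ _ _
      _ = ∫⁻ w, 31 * ∑ b, (A.history (noiselessLabeler C' α (g b)) w n).toOuterMeasure
          {h | A.halt h w ∧ boundaryDist (A.output h w) (g b) ≤ ENNReal.ofReal ε} ∂A.seedLaw :=
          (lintegral_const_mul' _ _ (by norm_num)).symm
      _ ≤ ∫⁻ _, 28 * 2 ^ N ∂A.seedLaw := lintegral_mono hpoint
      _ = 28 * 2 ^ N := by simp
  have hge : 31 * (2 ^ N * ENNReal.ofReal (1 - 1 / 16))
      ≤ 31 * ∑ b, A.successProb (noiselessLabeler C' α (g b)) (g b) ε n := by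
    gcongr
    calc _ = ∑ b : (Fin (d - 1) → Fin m) → Bool, ENNReal.ofReal (1 - 1 / 16) := by
          rw [Finset.sum_const, Finset.card_univ, nsmul_eq_mul, Fintype.card_fun,
            Fintype.card_bool]
          push_cast
          rfl
      _ ≤ _ := Finset.sum_le_sum fun b _ => hcon b
  have h := hge.trans hsum
  rw [show (2 : ℝ≥0∞) ^ N = ENNReal.ofReal (2 ^ N) by
      rw [ENNReal.ofReal_pow (by norm_num)]; simp,
    show (31 : ℝ≥0∞) = ENNReal.ofReal 31 by simp, show (28 : ℝ≥0∞) = ENNReal.ofReal 28 by simp,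
    ← ENNReal.ofReal_mul (by positivity), ← ENNReal.ofReal_mul (by positivity),
    ← ENNReal.ofReal_mul (by positivity), ENNReal.ofReal_le_ofReal_iff (by positivity)] at h
  have : (0 : ℝ) < 2 ^ N := by positivity
  linarith

/-- Success is monotone in the number of queries, so failure at `⌊r⌋₊` excludes all smaller budgets,
and every larger integer exceeds `r`. -/
theorem ActiveLearner.le_queryComplexity (A : ActiveLearner.{u} d) {P : ResponseLaw d}
    {g : BasePoint d → ℝ} {ε δ r : ℝ}
    (h : A.successProb P g ε ⌊r⌋₊ < ENNReal.ofReal (1 - δ)) :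
    ENNReal.ofReal r ≤ A.queryComplexity P g ε δ := by
  refine le_iInf₂ fun n hn => ?_
  have hlt : ⌊r⌋₊ < n := by
    by_contra! hle
    exact absurd (hn.trans (A.successProb_mono P g ε hle)) (not_le.2 h)
  rw [← ENNReal.ofReal_natCast]
  exact ENNReal.ofReal_le_ofReal (Nat.lt_of_floor_lt hlt).le

/-- A grid size adapted to bumps of height `η`. -/
theorem exists_grid_size {R γ : ℝ} (hR : 1 ≤ R) (hγ : 0 < γ) :
    ∃ m : ℕ, 0 < m ∧ (m : ℝ) ^ γ ≤ R ∧ R ^ (1 / γ) / 2 ≤ m := by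
  have h1 : 1 ≤ R ^ (1 / γ) := Real.one_le_rpow hR (by positivity)
  refine ⟨⌊R ^ (1 / γ)⌋₊, Nat.floor_pos.2 h1, ?_, ?_⟩
  · calc ((⌊R ^ (1 / γ)⌋₊ : ℝ)) ^ γ ≤ (R ^ (1 / γ)) ^ γ := by
          gcongr
          exact Nat.floor_le (by positivity)
      _ = R := by rw [← Real.rpow_mul (by linarith), one_div_mul_cancel hγ.ne', Real.rpow_one]
  · have h2 := Nat.lt_floor_add_one (R ^ (1 / γ))
    have h3 : (1 : ℝ) ≤ ⌊R ^ (1 / γ)⌋₊ := by exact_mod_cast Nat.floor_pos.2 h1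
    linarith

theorem exists_le_queryComplexity (hd : 2 ≤ d) {K γ C' α : ℝ} (hK : 0 < K) (hγ : 1 ≤ γ)
    (hC0 : 0 ≤ C') (hC1 : C' ≤ 1) (hα : 0 < α) (hα2 : α ≤ 2) :
    ∃ c : ℝ, 0 < c ∧ ∃ ε₀ : ℝ, 0 < ε₀ ∧ ∀ ε : ℝ, 0 < ε → ε ≤ ε₀ → ∀ A : ActiveLearner.{u} d,
      ∃ g ∈ smoothBoundaries d K γ,
        ENNReal.ofReal (c * ε ^ (-α - ((d : ℝ) - 1) / γ))
          ≤ A.queryComplexity (noiselessLabeler C' α g) g ε (1 / 16) := by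
  obtain ⟨B, hB, hsmooth⟩ := exists_cubeBoundary_mem_smoothBoundaries d hγ
  set v := (quarterBallVolume (d - 1)).toReal with hv_def
  have hv : 0 < v := ENNReal.toReal_pos (quarterBallVolume_pos _).ne' (quarterBallVolume_ne_top _)
  have hw : 0 < 1 - (3 / 4 : ℝ) ^ α := by
    have : (3 / 4 : ℝ) ^ α < 1 := Real.rpow_lt_one (by norm_num) (by norm_num) hα
    linarith
  set w := 1 - (3 / 4 : ℝ) ^ α with hw_def
  set a := 64 / v with ha_def
  have ha : 0 < a := by positivity
  have hγ0 : 0 < γ := by linarith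
  -- The first bound on `ε` gives `η ≤ 1 / 4`, the second `B * η ≤ K`, so that the grid has at least
  -- one cell.
  refine ⟨w / (4 * a ^ α) * (((K / (B * a)) ^ (1 / γ) / 2) ^ (d - 1)), by positivity,
    min (1 / (4 * a)) (K / (B * a)), by positivity, fun ε hε hε₀ A => ?_⟩
  set η := a * ε with hη_def
  have hη : 0 < η := by positivity
  have hη4 : η ≤ 1 / 4 := by
    calc η ≤ a * (1 / (4 * a)) := by
          rw [hη_def]; gcongr; exact hε₀.trans (min_le_left _ _)
      _ = 1 / 4 := by field_simp
  have hR : 1 ≤ K / (B * η) := by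
    rw [one_le_div (by positivity)]
    calc B * η ≤ B * (a * (K / (B * a))) := by
          rw [hη_def]; gcongr; exact hε₀.trans (min_le_right _ _)
      _ = K := by field_simp
  obtain ⟨m, hm, hmγ, hml⟩ := exists_grid_size hR hγ0
  have hBK : B * η * (m : ℝ) ^ γ ≤ K := by
    rw [mul_comm]
    exact (le_div_iff₀ (by positivity)).1 hmγ
  have hηα : 0 < η ^ α := Real.rpow_pos_of_pos hη α
  have hrate : w / (4 * a ^ α) * (((K / (B * a)) ^ (1 / γ) / 2) ^ (d - 1))
      * ε ^ (-α - ((d : ℝ) - 1) / γ) ≤ w / (4 * η ^ α) * (m : ℝ) ^ (d - 1) := by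
    have h1 : (K / (B * η)) ^ (1 / γ) = (K / (B * a)) ^ (1 / γ) * ε ^ (-(1 / γ)) := by
      rw [Real.rpow_neg hε.le, ← div_eq_mul_inv, ← Real.div_rpow (by positivity) hε.le, div_div,
        hη_def, mul_assoc]
    have h2 : ε ^ (-α - ((d : ℝ) - 1) / γ) = (ε ^ α)⁻¹ * (ε ^ (-(1 / γ))) ^ (d - 1) := by
      rw [← Real.rpow_natCast (ε ^ (-(1 / γ))), ← Real.rpow_mul hε.le, ← Real.rpow_neg hε.le,
        ← Real.rpow_add hε, Nat.cast_sub (by omega)]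
      congr 1
      push_cast
      ring
    have h3 : η ^ α = a ^ α * ε ^ α := Real.mul_rpow ha.le hε.le
    have h4 : ((K / (B * η)) ^ (1 / γ) / 2) ^ (d - 1) ≤ (m : ℝ) ^ (d - 1) := by gcongr
    refine le_trans (le_of_eq ?_) (mul_le_mul_of_nonneg_left h4 (by positivity))
    rw [h1, h2, h3, div_pow, div_pow, mul_pow]
    have : 0 < ε ^ α := Real.rpow_pos_of_pos hε α
    have : 0 < a ^ α := Real.rpow_pos_of_pos ha α
    field_simp
  have hηε : 64 * ε ≤ η * v := by
    rw [hη_def, ha_def]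
    refine le_of_eq ?_
    field_simp
  -- The largest query budget that the information condition `4 * (η ^ α / w * n) ≤ m ^ (d - 1)`
  -- allows.
  set r := w / (4 * η ^ α) * (m : ℝ) ^ (d - 1) with hr_def
  have hr : 0 ≤ r := by positivity
  obtain ⟨b, hb⟩ := exists_successProb_lt (d := d) (n := ⌊r⌋₊) A hC0 hC1 hα hα2 hm hη hη4 hε.le
    hηε (by
      calc 4 * (η ^ α / w * (⌊r⌋₊ : ℝ)) ≤ 4 * (η ^ α / w * r) := by
            gcongr
            exact Nat.floor_le hr
        _ = (m : ℝ) ^ (d - 1) := by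
            rw [hr_def]
            field_simp)
  exact ⟨cubeBoundary η b, hsmooth m K η b hη.le hη4 hBK,
    (ENNReal.ofReal_le_ofReal hrate).trans (A.le_queryComplexity hb)⟩

end LowerBound

end AbstainingLabeler

end

theorem mainTheorem6 :
    ∃ δ₀ : ℝ, 0 < δ₀ ∧ δ₀ < 1 ∧
      ∀ (d : ℕ) (_ : 2 ≤ d) (K γ : ℝ) (_ : 0 < K) (_ : 1 ≤ γ)
        (C' α : ℝ) (_ : 0 < C') (_ : C' ≤ 1) (_ : 0 < α) (_ : α ≤ 2)
        (C β : ℝ) (_ : 0 ≤ C) (_ : C ≤ 1) (_ : 0 ≤ β),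
      ∃ L : (AbstainingLabeler.BasePoint d → ℝ) → AbstainingLabeler.ResponseLaw d,
        (∀ g ∈ AbstainingLabeler.smoothBoundaries d K γ,
          (∀ y : AbstainingLabeler.Response, Measurable (fun x => L g x y)) ∧
          AbstainingLabeler.Condition1 (L g) g ∧
          AbstainingLabeler.Condition2 (fun x => C' * x ^ α) C β (L g) g ∧
          AbstainingLabeler.Condition3 (fun x => C' * x ^ α) (L g) g) ∧
        ∃ c : ℝ, 0 < c ∧ ∃ ε₀ : ℝ, 0 < ε₀ ∧
          ∀ ε : ℝ, 0 < ε → ε ≤ ε₀ → ∀ A : AbstainingLabeler.ActiveLearner.{u} d,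
            ∃ g ∈ AbstainingLabeler.smoothBoundaries d K γ,
              ENNReal.ofReal (c * ε ^ (-α - ((d : ℝ) - 1) / γ))
                ≤ A.queryComplexity (L g) g ε δ₀ := by
  refine ⟨1 / 16, by norm_num, by norm_num, ?_⟩
  intro d hd K γ hK hγ C' α hC0 hC1 hα hα2 C β hC hC' hβ
  refine ⟨AbstainingLabeler.noiselessLabeler C' α, fun g hg => ⟨fun y => ?_, ?_, ?_, ?_⟩, ?_⟩
  · exact AbstainingLabeler.measurable_noiselessLabeler
      (AbstainingLabeler.measurable_of_mem_smoothBoundaries hg) y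
  · exact AbstainingLabeler.condition1_noiselessLabeler hC0.le hC1 hα.le hg.1
  · exact AbstainingLabeler.condition2_noiselessLabeler hC0.le hC1 hα.le hC hC' hβ hg.1
  · exact AbstainingLabeler.condition3_noiselessLabeler hC0 hC1 hα hg.1
  · exact AbstainingLabeler.exists_le_queryComplexity hd hK hγ hC0.le hC1 hα hα2
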